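/- Let $\Bbbk$ be an algebraically closed field and let $X$ be a variety over $\Bbbk$, i.e. a reduced separated scheme of finite type over $\Bbbk$ (possibly reducible); points of $X$ are its $\Bbbk$-rational (closed) points, with the Zariski topology, and $\operatorname{Aut}(X)$ is the group of automorphisms of $X$ over $\Bbbk$. For a variety $A$, a map $\rho\colon A\to\operatorname{Aut}(X)$ is called a morphism if $A\times X\to X$, $(a,x)\mapsto\rho(a)(x)$, is a morphism of varieties. A subset of $\operatorname{Aut}(X)$ is irreducible constructible if it is the image of a morphism $A\to\operatorname{Aut}(X)$ with $A$ an irreducible variety. A subgroup $\mathcal G\subseteq\operatorname{Aut}(X)$ is connected if for every $g\in\mathcal G$ there are an irreducible variety $A$ and a morphism $\rho\colon A\to\operatorname{Aut}(X)$ with $\rho(A)\subseteq\mathcal G$ and $g,\operatorname{id}_X\in\rho(A)$. A connected algebraic subgroup of $\operatorname{Aut}(X)$ is the image of a group homomorphism $H\to\operatorname{Aut}(X)$ that is a morphism, where $H$ is a connected algebraic group (a group object in varieties). Let $\mathcal G\subseteq\operatorname{Aut}(X)$ be a connected subgroup. Then: (1) Every orbit $\mathcal G x$, $x\in X$, is open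 in its closure, locally closed in $X$, and smooth (with its structure of a reduced locally closed subvariety). (2) There is an irreducible constructible subset $V\subseteq\operatorname{Aut}(X)$ with $\operatorname{id}_X\in V\subseteq\mathcal G$ and $\mathcal G x=Vx$ for all $x\in X$. Moreover, if $\rho\colon A\to\operatorname{Aut}(X)$ is a morphism such that $A$ is irreducible, $\operatorname{id}_X\in\rho(A)$, and $\rho(A)$ generates $\mathcal G$, then for some $m\ge 1$ the set $V=(\rho(A)\cdot\rho(A)^{-1})^m$ has these properties. (3) Let $X_{\max}$ be the union of the orbits of maximal dimension $\max\{\dim\mathcal G x\mid x\in X\}$. Then $X_{\max}$ is open in $X$ (and it is non-empty, i.e. the maximum exists, if $X\neq\emptyset$). (4) Let $\mathcal S$ be a set of connected algebraic subgroups of $\operatorname{Aut}(X)$ that is covering, i.e. $\mathcal G=\bigcup_{G\in\mathcal S}G$, and directed, i.e. for all $G_1,G_2\in\mathcal S$ there is $G\in\mathcal S$ containing both. Then there is $G\in\mathcal S$ such that $\mathcal G x=Gx$ for all $x\in X$. -/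

import Mathlib

open CategoryTheory MonoidalCategory CartesianMonoidalCategory AlgebraicGeometry
open scoped MonObj Pointwise

universe u

namespace AutVariety

noncomputable section

variable {k : Type u} [Field k]

/-- A `k`-scheme is a (possibly reducible) variety if it is reduced, separated and of finite type
over `k`. (The base field will always be algebraically closed.) -/
structure IsVariety (X : Over (Spec (.of k))) : Prop where
  isReduced : IsReduced X.left
  isSeparated : IsSeparated X.hom
  locallyOfFiniteType : LocallyOfFiniteType X.hom
  quasiCompact : QuasiCompact X.hom

/-- An irreducible (in particular non-empty) variety. -/
structure IsIrreducibleVariety (X : Over (Spec (.of k))) : Prop extends IsVariety X where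
  irreducibleSpace : IrreducibleSpace X.left

/-- The points of a variety, i.e. its `k`-rational points `Spec k ⟶ X` over `k`. For `k`
algebraically closed these are the closed points of the scheme `X`. -/
abbrev Points (X : Over (Spec (.of k))) : Type u := 𝟙_ (Over (Spec (.of k))) ⟶ X

/-- The point of the underlying space of the scheme `X` given by a `k`-rational point. -/
def Points.toScheme {X : Over (Spec (.of k))} (x : Points X) : X.left :=
  x.left (IsLocalRing.closedPoint k)

/-- The Zariski topology on the set of points of `X`. -/
instance Points.instTopologicalSpace (X : Over (Spec (.of k))) : TopologicalSpace (Points X) :=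
  .induced Points.toScheme inferInstance

/-- The action of the automorphism group `Aut X` on the points of `X`. The product in `Aut X` is
`f * g = f ∘ g`. -/
instance Points.instMulAction (X : Over (Spec (.of k))) : MulAction (Aut X) (Points X) where
  smul g x := x ≫ g.hom
  one_smul x := Category.comp_id x
  mul_smul g h x := (Category.assoc x h.hom g.hom).symm

theorem Points.smul_def {X : Over (Spec (.of k))} (g : Aut X) (x : Points X) :
    g • x = x ≫ g.hom := rfl

/-- A map `ρ : A → Aut X` is a morphism if `(a, x) ↦ ρ a x` is a morphism `A × X ⟶ X`
of varieties. -/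
def IsMorphism {A X : Over (Spec (.of k))} (ρ : Points A → Aut X) : Prop :=
  ∃ φ : A ⊗ X ⟶ X, ∀ (a : Points A) (x : Points X), lift a x ≫ φ = ρ a • x

/-- A subset of `Aut X` is an irreducible constructible subset if it is the image of a morphism
`A → Aut X` from an irreducible variety `A`. -/
def IsIrreducibleConstructible {X : Over (Spec (.of k))} (V : Set (Aut X)) : Prop :=
  ∃ A : Over (Spec (.of k)), IsIrreducibleVariety A ∧
    ∃ ρ : Points A → Aut X, IsMorphism ρ ∧ Set.range ρ = V

/-- A subgroup `G` of `Aut X` is connected if every element of `G` lies together with the identity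
in the image of a morphism `A → Aut X` with values in `G`, for some irreducible variety `A`. -/
def IsConnectedSubgroup {X : Over (Spec (.of k))} (G : Subgroup (Aut X)) : Prop :=
  ∀ g ∈ G, ∃ A : Over (Spec (.of k)), IsIrreducibleVariety A ∧
    ∃ ρ : Points A → Aut X, IsMorphism ρ ∧ Set.range ρ ⊆ G ∧ g ∈ Set.range ρ ∧ 1 ∈ Set.range ρ

/-- A subgroup of `Aut X` is a connected algebraic subgroup if it is the image of a connected
algebraic group `H` (a group object in varieties) acting on `X`, i.e. of a group homomorphism
`H → Aut X` which is a morphism. -/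
def IsConnectedAlgebraicSubgroup {X : Over (Spec (.of k))} (G : Subgroup (Aut X)) : Prop :=
  ∃ (H : Over (Spec (.of k))) (_ : GrpObj H), IsVariety H ∧ ConnectedSpace H.left ∧
    ∃ ρ : Points H →* Aut X, IsMorphism ρ ∧ ρ.range = G

/-- A set `O` of points of `X` is (the set of points of) a smooth locally closed subvariety: it is
the set of points of some smooth variety `Z` immersed in `X`. As `Z` is reduced, it is necessarily
`O` with its reduced subscheme structure. -/
def IsSmoothSubvariety {X : Over (Spec (.of k))} (O : Set (Points X)) : Prop :=
  ∃ Z : Over (Spec (.of k)), IsVariety Z ∧ AlgebraicGeometry.Smooth Z.hom ∧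
    ∃ i : Z ⟶ X, IsImmersion i.left ∧ Set.range (fun z : Points Z ↦ z ≫ i) = O

/-- The dimension of the orbit of `x` under `G`, with respect to the Zariski topology. -/
def orbitDim {X : Over (Spec (.of k))} (G : Subgroup (Aut X)) (x : Points X) : WithBot ℕ∞ :=
  topologicalKrullDim (MulAction.orbit G x)

/-- The maximal dimension of the orbits of `G` in `X`. -/
def maxOrbitDim {X : Over (Spec (.of k))} (G : Subgroup (Aut X)) : WithBot ℕ∞ :=
  ⨆ x : Points X, orbitDim G x

/-- The union of the orbits of maximal dimension. -/
def maxLocus {X : Over (Spec (.of k))} (G : Subgroup (Aut X)) : Set (Points X) :=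
  ⋃ (x : Points X) (_ : orbitDim G x = maxOrbitDim G), MulAction.orbit G x

/-- `V` is an irreducible constructible subset of `Aut X`, contained in `G` and containing the
identity, such that `G x = V x` for all points `x` of `X`. -/
structure ParametrizesOrbits {X : Over (Spec (.of k))} (G : Subgroup (Aut X))
    (V : Set (Aut X)) : Prop where
  isIrreducibleConstructible : IsIrreducibleConstructible V
  subset : V ⊆ G
  one_mem : 1 ∈ V
  orbit_eq : ∀ x : Points X, MulAction.orbit G x = (fun g ↦ g • x) '' V

end

end AutVariety

/-!
Throughout, `X` is a variety over an algebraically closed field and `G` is a connected group of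
automorphisms of `X`. Everything is deduced from a uniform parametrization of the orbits.

*Uniformity.* The group `G` is covered by a family of irreducible constructible subsets `F` which
contain `1` and which is directed with respect to products and inverses (`IsOrbitCover`). For an
irreducible closed subset `Y` of `X`, the closures of the sets `{(g z, z) | g ∈ F, z ∈ Y}` in
`X × X` are irreducible, so they are bounded in dimension, and there is an `F` for which the closure
is maximal; it then contains `(g z, z)` for all `g ∈ G`. By Chevalley's theorem, the set itself
contains a non-empty open subset of its closure. Slicing, one sees that `F x` contains a non-empty
open subset of `G x` for all `x` in a non-empty open subset of `Y`. By Noetherian induction, one `F`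
works for all `x ∈ X`, and since two non-empty open subsets of the irreducible set `G x` meet,
`F⁻¹ F x = G x` (`IsOrbitCover.exists_orbit_eq`). The family `F` may consist of all irreducible
constructible subsets of `G` containing `1`, of the powers of `R R⁻¹` for an irreducible
constructible set `R` of generators, or of a directed covering by connected algebraic subgroups;
the latter are irreducible by homogeneity (`irreducibleSpace_of_homogeneous`).

*Inverses.* For this it is needed that the inverse of an algebraic family of automorphisms
`ρ : A → Aut X` is algebraic (`IsMorphism.inv`), i.e. that `(a, x) ↦ (a, ρ a x)` is an automorphism
of `A × X`. This morphism over `A` is an isomorphism on the slices over points of `A`. Hence it is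
flat and unramified by a fibrewise criterion (`flat_of_bijective_quotient`), and being bijective on
rational points, it is an isomorphism.

*Orbits.* An orbit is the image of an irreducible variety, so it contains a non-empty open subset of
its closure, and by homogeneity it is locally closed. It meets the smooth locus of its closure,
which is stable under `G`, so it is smooth (`isSmoothSubvariety_orbit`).

*Dimension.* The dimension of the orbit of `x` is the transcendence degree of the residue field at
the generic point of its closure (`Points.topologicalKrullDim_eq_residueTrdeg`), which is the image
of the generic point of the parametrizing variety under the orbit map of `x`. Restrict the orbit map
of `x₀` to a closed subvariety `B` on which it is generically quasi-finite, with an image of the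
same dimension. As the quasi-finite locus of a morphism is open, the orbit maps of nearby points are
generically quasi-finite on `B` as well, so their orbits have at least the same dimension
(`eventually_residueTrdeg_le`). Since the dimension of the orbits is bounded, the orbits of maximal
dimension form an open set.
-/

/-! ### Constructible sets and directed families of irreducible sets -/

namespace AutVariety

open Topology TopologicalSpace

section Constructible

variable {P Q : Type*} [TopologicalSpace P] [TopologicalSpace Q]

/-- The set `E` contains a non-empty open subset of its closure. -/
def ContainsOpenOfClosure (E : Set P) : Prop :=
  ∃ U, IsOpen U ∧ (E ∩ U).Nonempty ∧ closure E ∩ U ⊆ E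

/-- A constructible set or its complement is a neighbourhood of the generic point of every
irreducible set; this is stable under unions and complements. -/
theorem _root_.Topology.IsConstructible.exists_inter_subset_or {s : Set Q} (hs : IsConstructible s)
    {Z : Set Q} (hZ : IsIrreducible Z) :
    (∃ U, IsOpen U ∧ (Z ∩ U).Nonempty ∧ Z ∩ U ⊆ s) ∨
      ∃ U, IsOpen U ∧ (Z ∩ U).Nonempty ∧ Z ∩ U ⊆ sᶜ := by
  induction hs using IsConstructible.empty_union_induction with
  | open_retrocompact U hU _ =>
    by_cases h : (Z ∩ U).Nonempty
    · exact .inl ⟨U, hU, h, Set.inter_subset_right⟩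
    · refine .inr ⟨Set.univ, isOpen_univ, by simpa using hZ.nonempty, fun z hz hzU ↦ ?_⟩
      exact h ⟨z, hz.1, hzU⟩
  | union s hs t ht hs' ht' =>
    rcases hs' with ⟨U, hU, hne, hsub⟩ | ⟨U, hU, hne, hsub⟩
    · exact .inl ⟨U, hU, hne, hsub.trans Set.subset_union_left⟩
    rcases ht' with ⟨V, hV, hne', hsub'⟩ | ⟨V, hV, hne', hsub'⟩
    · exact .inl ⟨V, hV, hne', hsub'.trans Set.subset_union_right⟩
    · refine .inr ⟨U ∩ V, hU.inter hV, hZ.isPreirreducible U V hU hV hne hne', ?_⟩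
      rintro z ⟨hz, hzU, hzV⟩ (h | h)
      exacts [hsub ⟨hz, hzU⟩ h, hsub' ⟨hz, hzV⟩ h]
  | compl s hs hs' => rw [compl_compl]; exact hs'.symm

/-- If a constructible set were not a neighbourhood of the generic point of the closure of an
irreducible preimage, then its complement would meet this preimage. -/
theorem containsOpenOfClosure_preimage {f : P → Q} (hf : Continuous f) {s : Set Q}
    (hs : IsConstructible s) (h : IsIrreducible (f ⁻¹' s)) : ContainsOpenOfClosure (f ⁻¹' s) := by
  rcases hs.exists_inter_subset_or (h.closure.image f hf.continuousOn) with
    ⟨U, hU, ⟨_, ⟨p, hp, rfl⟩, hpU⟩, hsub⟩ | ⟨U, hU, ⟨_, ⟨p, hp, rfl⟩, hpU⟩, hsub⟩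
  · obtain ⟨q, hqU, hq⟩ := mem_closure_iff.mp hp _ (hU.preimage hf) hpU
    exact ⟨f ⁻¹' U, hU.preimage hf, ⟨q, hq, hqU⟩,
      fun z hz ↦ hsub ⟨Set.mem_image_of_mem _ hz.1, hz.2⟩⟩
  · obtain ⟨q, hqU, hq⟩ := mem_closure_iff.mp hp _ (hU.preimage hf) hpU
    exact absurd hq (hsub ⟨Set.mem_image_of_mem _ (subset_closure hq), hqU⟩)

theorem isIrreducible_of_directed_cover {J : Type*} {E : Set P} {S : J → Set P}
    (hE : E = ⋃ i, S i) (hdir : Directed (· ⊆ ·) S) (hne : E.Nonempty)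
    (hirr : ∀ i, IsIrreducible (S i)) : IsIrreducible E := by
  refine ⟨hne, fun U V hU hV ⟨u, hu, huU⟩ ⟨v, hv, hvV⟩ ↦ ?_⟩
  rw [hE, Set.mem_iUnion] at hu hv
  obtain ⟨i, hi⟩ := hu
  obtain ⟨j, hj⟩ := hv
  obtain ⟨l, hil, hjl⟩ := hdir i j
  obtain ⟨w, hw, hw'⟩ := (hirr l).isPreirreducible U V hU hV ⟨u, hil hi, huU⟩ ⟨v, hjl hj, hvV⟩
  exact ⟨w, hE ▸ Set.mem_iUnion_of_mem l hw, hw'⟩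

/-- A set swept out by an irreducible set `Z` and an irreducible space, through a map `m` which is
only separately continuous, is irreducible. This applies to products of varieties, whose topology
is finer than the product topology. -/
theorem isIrreducible_image2 {A R : Type*} [TopologicalSpace A] [TopologicalSpace R]
    [IrreducibleSpace A] {Z : Set P} (hZ : IsIrreducible Z) (m : A → P → R)
    (h₁ : ∀ z, Continuous fun a ↦ m a z) (h₂ : ∀ a, Continuous (m a)) :
    IsIrreducible (Set.image2 m Set.univ Z) := by
  refine ⟨Set.Nonempty.image2 Set.univ_nonempty hZ.nonempty, ?_⟩
  rintro U V hU hV ⟨_, ⟨a, -, z, hz, rfl⟩, hzU⟩ ⟨_, ⟨b, -, w, hw, rfl⟩, hwV⟩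
  obtain ⟨y, hy, hyU, hyV⟩ := hZ.isPreirreducible _ _ (hU.preimage (h₂ a)) (hV.preimage (h₂ b))
    ⟨z, hz, hzU⟩ ⟨w, hw, hwV⟩
  obtain ⟨c, -, hcU, hcV⟩ := (IrreducibleSpace.isIrreducible_univ A).isPreirreducible _ _
    (hU.preimage (h₁ y)) (hV.preimage (h₁ y)) ⟨a, trivial, hyU⟩ ⟨b, trivial, hyV⟩
  exact ⟨m c y, ⟨c, trivial, y, hy, rfl⟩, hcU, hcV⟩

end Constructible

section Orbits

variable {M P : Type*} [Group M] [TopologicalSpace P] [MulAction M P]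

/-- A family of subsets of `M` containing `1` which covers the subgroup `G` and is directed with
respect to products and inverses. -/
structure IsOrbitCover (G : Subgroup M) (𝓕 : Set (Set M)) : Prop where
  subset : ∀ F ∈ 𝓕, F ⊆ G
  one_mem : ∀ F ∈ 𝓕, 1 ∈ F
  exists_mem : ∀ g ∈ G, ∃ F ∈ 𝓕, g ∈ F
  exists_mul_subset : ∀ F₁ ∈ 𝓕, ∀ F₂ ∈ 𝓕, ∃ F ∈ 𝓕, F₁ * F₂ ⊆ F
  exists_inv_subset : ∀ F ∈ 𝓕, ∃ F' ∈ 𝓕, F⁻¹ ⊆ F'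

namespace IsOrbitCover

variable {G : Subgroup M} {𝓕 : Set (Set M)} (h : IsOrbitCover G 𝓕)

include h

theorem exists_union_subset {F₁ F₂ : Set M} (h₁ : F₁ ∈ 𝓕) (h₂ : F₂ ∈ 𝓕) :
    ∃ F ∈ 𝓕, F₁ ⊆ F ∧ F₂ ⊆ F := by
  obtain ⟨F, hF, hsub⟩ := h.exists_mul_subset F₁ h₁ F₂ h₂
  refine ⟨F, hF, fun g hg ↦ hsub ?_, fun g hg ↦ hsub ?_⟩
  · exact ⟨g, hg, 1, h.one_mem _ h₂, mul_one g⟩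
  · exact ⟨1, h.one_mem _ h₁, g, hg, one_mul g⟩

theorem isIrreducible_orbit (hirr : ∀ F ∈ 𝓕, ∀ x : P, IsIrreducible ((· • x) '' F)) (x : P) :
    IsIrreducible (MulAction.orbit G x) := by
  refine isIrreducible_of_directed_cover (S := fun F : 𝓕 ↦ (· • x) '' (F : Set M)) ?_ ?_
    (MulAction.nonempty_orbit x) fun F ↦ hirr F F.2 x
  · ext y
    simp only [MulAction.mem_orbit_iff, Set.mem_iUnion, Set.mem_image, Subtype.exists,
      Subgroup.mk_smul, exists_prop]
    constructor
    · rintro ⟨g, hg, rfl⟩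
      obtain ⟨F, hF, hgF⟩ := h.exists_mem g hg
      exact ⟨F, hF, g, hgF, rfl⟩
    · rintro ⟨F, hF, g, hg, rfl⟩
      exact ⟨g, h.subset F hF hg, rfl⟩
  · intro F₁ F₂
    obtain ⟨F, hF, h₁, h₂⟩ := h.exists_union_subset F₁.2 F₂.2
    exact ⟨⟨F, hF⟩, Set.image_mono h₁, Set.image_mono h₂⟩

omit [TopologicalSpace P] in
theorem image_subset_orbit {F : Set M} (hF : F ∈ 𝓕) (x : P) :
    (· • x) '' F ⊆ MulAction.orbit G x := by
  rintro _ ⟨g, hg, rfl⟩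
  exact ⟨⟨g, h.subset F hF hg⟩, rfl⟩

/-- If `F x` contains a non-empty open subset of the orbit of `x` for every `x`, then `F⁻¹ F`
already sweeps out all orbits: two non-empty open subsets of the irreducible set `G x` meet. -/
theorem exists_orbit_eq_of_open (hirr : ∀ F ∈ 𝓕, ∀ x : P, IsIrreducible ((· • x) '' F))
    {F : Set M} (hF : F ∈ 𝓕) (hopen : ∀ x : P, ∃ U, IsOpen U ∧
      (MulAction.orbit G x ∩ U).Nonempty ∧ MulAction.orbit G x ∩ U ⊆ (· • x) '' F) :
    ∃ F' ∈ 𝓕, ∀ x : P, MulAction.orbit G x = (· • x) '' F' := by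
  obtain ⟨F₁, hF₁, hinv⟩ := h.exists_inv_subset F hF
  obtain ⟨F₂, hF₂, hmul⟩ := h.exists_mul_subset F₁ hF₁ F hF
  refine ⟨F₂, hF₂, fun x ↦ (Set.Subset.antisymm ?_ (h.image_subset_orbit hF₂ x))⟩
  intro y hy
  obtain ⟨U, hU, hne, hsub⟩ := hopen x
  obtain ⟨V, hV, hne', hsub'⟩ := hopen y
  rw [MulAction.orbit_eq_iff.mpr hy] at hne' hsub'
  obtain ⟨z, hz, hzU, hzV⟩ := (h.isIrreducible_orbit hirr x).isPreirreducible U V hU hV hne hne'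
  obtain ⟨g, hg, hgz : g • x = z⟩ := hsub ⟨hz, hzU⟩
  obtain ⟨g', hg', hgz' : g' • y = z⟩ := hsub' ⟨hz, hzV⟩
  refine ⟨g'⁻¹ * g, hmul (Set.mul_mem_mul (hinv (by simpa using hg')) hg), ?_⟩
  change (g'⁻¹ * g) • x = y
  rw [mul_smul, hgz, ← hgz', inv_smul_smul]

/-- The uniformity of orbits. The map `pair` plays the role of `P × P → Q` where `Q` is the set of
points of the product variety, whose topology is finer than the product topology. The hypotheses
`hirr'` and `hopen` say that the sets `{(g z, z) | g ∈ F, z ∈ Z}` are irreducible and contain a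
non-empty open subset of their closure. -/
theorem exists_orbit_eq [NoetherianSpace P] {Q : Type*} [TopologicalSpace Q]
    [WellFoundedGT (IrreducibleCloseds Q)] (pair : P → P → Q)
    (hinj : ∀ {x x' y y'}, pair y x = pair y' x' → y = y' ∧ x = x')
    (hc₁ : ∀ g : M, Continuous fun z ↦ pair (g • z) z) (hc₂ : ∀ x, Continuous fun y ↦ pair y x)
    (hirr : ∀ F ∈ 𝓕, ∀ x : P, IsIrreducible ((· • x) '' F))
    (hirr' : ∀ F ∈ 𝓕, ∀ Z : Set P, IsClosed Z → IsIrreducible Z →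
      IsIrreducible (Set.image2 (fun g z ↦ pair (g • z) z) F Z))
    (hopen : ∀ F ∈ 𝓕, ∀ Z : Set P, IsClosed Z → IsIrreducible Z →
      ContainsOpenOfClosure (Set.image2 (fun g z ↦ pair (g • z) z) F Z)) :
    ∃ F ∈ 𝓕, ∀ x : P, MulAction.orbit G x = (· • x) '' F := by
  -- Noetherian induction: it suffices to treat the points of a closed subset `Y`.
  suffices H : ∀ Y : Closeds P, ∃ F ∈ 𝓕, ∀ x ∈ Y, ∃ U, IsOpen U ∧
      (MulAction.orbit G x ∩ U).Nonempty ∧ MulAction.orbit G x ∩ U ⊆ (· • x) '' F by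
    obtain ⟨F, hF, hFx⟩ := H ⊤
    exact h.exists_orbit_eq_of_open hirr hF fun x ↦ hFx x trivial
  have union {Y₁ Y₂ Y : Set P} (hY : Y ⊆ Y₁ ∪ Y₂)
      (h₁ : ∃ F ∈ 𝓕, ∀ x ∈ Y₁, ∃ U, IsOpen U ∧
        (MulAction.orbit G x ∩ U).Nonempty ∧ MulAction.orbit G x ∩ U ⊆ (· • x) '' F)
      (h₂ : ∃ F ∈ 𝓕, ∀ x ∈ Y₂, ∃ U, IsOpen U ∧
        (MulAction.orbit G x ∩ U).Nonempty ∧ MulAction.orbit G x ∩ U ⊆ (· • x) '' F) :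
      ∃ F ∈ 𝓕, ∀ x ∈ Y, ∃ U, IsOpen U ∧
        (MulAction.orbit G x ∩ U).Nonempty ∧ MulAction.orbit G x ∩ U ⊆ (· • x) '' F := by
    obtain ⟨F₁, hF₁, h₁⟩ := h₁
    obtain ⟨F₂, hF₂, h₂⟩ := h₂
    obtain ⟨F, hF, hs₁, hs₂⟩ := h.exists_union_subset hF₁ hF₂
    refine ⟨F, hF, fun x hx ↦ ?_⟩
    rcases hY hx with hx | hx
    · obtain ⟨U, hU, hne, hsub⟩ := h₁ x hx
      exact ⟨U, hU, hne, hsub.trans (Set.image_mono hs₁)⟩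
    · obtain ⟨U, hU, hne, hsub⟩ := h₂ x hx
      exact ⟨U, hU, hne, hsub.trans (Set.image_mono hs₂)⟩
  intro Y
  induction Y using WellFoundedLT.induction with
  | ind Y ih =>
  rcases Set.eq_empty_or_nonempty (Y : Set P) with hY | hY
  · obtain ⟨F, hF, -⟩ := h.exists_mem 1 G.one_mem
    refine ⟨F, hF, fun x hx ↦ ?_⟩
    have : x ∈ (Y : Set P) := hx
    simp [hY] at this
  by_cases hY' : IsPreirreducible (Y : Set P)
  swap
  · rw [isPreirreducible_iff_isClosed_union_isClosed] at hY'
    push Not at hY'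
    obtain ⟨Z₁, Z₂, hZ₁, hZ₂, hsub, hn₁, hn₂⟩ := hY'
    have key {Z : Set P} (hZ : IsClosed Z) (hn : ¬ (Y : Set P) ⊆ Z) :
        (⟨Y ∩ Z, Y.isClosed.inter hZ⟩ : Closeds P) < Y :=
      lt_of_le_of_ne (fun x hx ↦ hx.1) fun e ↦ hn fun x hx ↦ by
        exact (e.ge hx).2
    exact union (Y₁ := Y ∩ Z₁) (Y₂ := Y ∩ Z₂)
      (fun x hx ↦ (hsub hx).imp (⟨hx, ·⟩) (⟨hx, ·⟩)) (ih _ (key hZ₁ hn₁)) (ih _ (key hZ₂ hn₂))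
  have hYirr : IsIrreducible (Y : Set P) := ⟨hY, hY'⟩
  -- Choose `F` such that the closure of `{(g z, z) | g ∈ F, z ∈ Y}` is maximal; then this closure
  -- contains `(g z, z)` for all `g ∈ G` and `z ∈ Y`.
  let C (F : 𝓕) : IrreducibleCloseds Q :=
    ⟨closure (Set.image2 (fun g z ↦ pair (g • z) z) F.1 Y),
      (hirr' F F.2 Y Y.isClosed hYirr).closure, isClosed_closure⟩
  obtain ⟨F₀, hF₀, -⟩ := h.exists_mem 1 G.one_mem
  obtain ⟨_, ⟨F, rfl⟩, hmax⟩ := WellFounded.has_min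
    (wellFounded_gt (α := IrreducibleCloseds Q)) (Set.range C) ⟨_, ⟨⟨F₀, hF₀⟩, rfl⟩⟩
  have hC (g : M) (hg : g ∈ G) (z : P) (hz : z ∈ Y) :
      pair (g • z) z ∈ closure (Set.image2 (fun g z ↦ pair (g • z) z) (F : Set M) Y) := by
    obtain ⟨F', hF', hgF'⟩ := h.exists_mem g hg
    obtain ⟨F'', hF'', hs, hs'⟩ := h.exists_union_subset F.2 hF'
    have hle : C F ≤ C ⟨F'', hF''⟩ := fun q hq ↦
      closure_mono (Set.image2_subset_right hs) hq
    have heq : C F = C ⟨F'', hF''⟩ :=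
      hle.eq_or_lt.resolve_right (hmax _ ⟨_, rfl⟩)
    have : pair (g • z) z ∈ C ⟨F'', hF''⟩ :=
      subset_closure ⟨g, hs' hgF', z, hz, rfl⟩
    rw [← heq] at this
    exact this
  obtain ⟨U, hU, ⟨_, ⟨g₀, hg₀, z₀, hz₀, rfl⟩, hU₀⟩, hsub⟩ := hopen F F.2 Y Y.isClosed hYirr
  have hO : IsOpen {z : P | ∃ g ∈ (F : Set M), pair (g • z) z ∈ U} := by
    have : {z : P | ∃ g ∈ (F : Set M), pair (g • z) z ∈ U} =
        ⋃ g ∈ (F : Set M), (fun z ↦ pair (g • z) z) ⁻¹' U := by ext; simp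
    rw [this]
    exact isOpen_biUnion fun g _ ↦ hU.preimage (hc₁ g)
  refine union (Y₁ := {z | z ∈ Y ∧ ∃ g ∈ (F : Set M), pair (g • z) z ∈ U})
    (Y₂ := Y ∩ {z : P | ∃ g ∈ (F : Set M), pair (g • z) z ∈ U}ᶜ) (fun x hx ↦ ?_)
    ⟨F, F.2, ?_⟩ (ih ⟨_, Y.isClosed.inter hO.isClosed_compl⟩ ?_)
  · by_cases hx' : ∃ g ∈ (F : Set M), pair (g • x) x ∈ U
    exacts [.inl ⟨hx, hx'⟩, .inr ⟨hx, hx'⟩]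
  -- For `x` in the open subset of `Y`, the orbit of `x` meets the slice of `U` over `x` in `F x`.
  · rintro x ⟨hx, g, hg, hgU⟩
    refine ⟨(fun y ↦ pair y x) ⁻¹' U, hU.preimage (hc₂ x),
      ⟨g • x, ⟨⟨g, h.subset F F.2 hg⟩, rfl⟩, hgU⟩, ?_⟩
    rintro _ ⟨⟨⟨g', hg'⟩, rfl⟩, hU'⟩
    obtain ⟨g'', hg'', z, hz, e⟩ := hsub ⟨hC g' hg' x hx, hU'⟩
    obtain ⟨e₁, rfl⟩ := hinj e
    exact ⟨g'', hg'', e₁⟩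
  · refine lt_of_le_of_ne (fun x hx ↦ hx.1) fun e ↦ ?_
    exact (e.ge hz₀).2 ⟨g₀, hg₀, hU₀⟩

end IsOrbitCover

end Orbits

end AutVariety

/-! ### Flatness from the infinitesimal fibres -/

namespace AutVariety

open TensorProduct in
/-- If `f : S → T` is an isomorphism modulo `I` and `T` is flat, then `f` is an isomorphism after
tensoring with any module killed by a power of `I`. -/
theorem bijective_rTensor_of_pow_smul_eq_bot {R S T : Type*} [CommRing R] [AddCommGroup S]
    [Module R S] [AddCommGroup T] [Module R T] [Module.Flat R T] (f : S →ₗ[R] T) (I : Ideal R)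
    (hf : Function.Bijective (f.rTensor (R ⧸ I))) (n : ℕ) :
    ∀ (M : Type _) [AddCommGroup M] [Module R M], I ^ n • (⊤ : Submodule R M) = ⊥ →
      Function.Bijective (f.rTensor M) := by
  have key : ∀ (M : Type _) [AddCommGroup M] [Module R M],
      I • (⊤ : Submodule R M) = ⊥ → Function.Bijective (f.rTensor M) := by
    intro M _ _ hM
    let e : ((R ⧸ I) ⊗[R] M) ≃ₗ[R] M :=
      TensorProduct.quotTensorEquivQuotSMul M I ≪≫ₗ Submodule.quotEquivOfEqBot _ hM
    have h1 : Function.Bijective (f.rTensor ((R ⧸ I) ⊗[R] M)) := by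
      rw [LinearMap.rTensor_tensor]
      simp only [LinearMap.coe_comp, LinearEquiv.coe_coe, EquivLike.comp_bijective,
        EquivLike.bijective_comp]
      let E := LinearEquiv.ofBijective _ hf
      exact (TensorProduct.congr E (LinearEquiv.refl R M)).bijective
    have h2 : f.rTensor M ∘ₗ e.toLinearMap.lTensor S =
        e.toLinearMap.lTensor T ∘ₗ f.rTensor ((R ⧸ I) ⊗[R] M) := by
      rw [LinearMap.lTensor_comp_rTensor, LinearMap.rTensor_comp_lTensor]
    have h3 : Function.Bijective (f.rTensor M ∘ₗ e.toLinearMap.lTensor S) := by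
      rw [h2]
      exact (LinearEquiv.lTensor T e).bijective.comp h1
    exact (Function.Bijective.of_comp_iff _ (LinearEquiv.lTensor S e).bijective).mp h3
  induction n with
  | zero =>
    intro M _ _ hM
    refine key M (eq_bot_iff.mpr ?_)
    rw [← hM, pow_zero, Ideal.one_eq_top, Submodule.top_smul]
    exact le_top
  | succ n ih =>
    intro M _ _ hM
    let N : Submodule R M := I • ⊤
    have hN : Function.Bijective (f.rTensor N) := by
      refine ih N ?_
      apply Submodule.map_injective_of_injective N.injective_subtype
      rw [Submodule.map_smul'', Submodule.map_top, Submodule.range_subtype, Submodule.map_bot,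
        ← Submodule.mul_smul, ← pow_succ, hM]
    have hQ : Function.Bijective (f.rTensor (M ⧸ N)) := by
      refine key _ ?_
      rw [← Submodule.range_mkQ N, ← Submodule.map_top, ← Submodule.map_smul'',
        Submodule.mkQ_map_self]
    have c1 (x : S ⊗[R] N) : f.rTensor M (N.subtype.lTensor S x) =
        N.subtype.lTensor T (f.rTensor N x) := by
      simp only [← LinearMap.comp_apply, LinearMap.lTensor_comp_rTensor,
        LinearMap.rTensor_comp_lTensor]
    have c2 (x : S ⊗[R] M) : f.rTensor (M ⧸ N) (N.mkQ.lTensor S x) =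
        N.mkQ.lTensor T (f.rTensor M x) := by
      simp only [← LinearMap.comp_apply, LinearMap.lTensor_comp_rTensor,
        LinearMap.rTensor_comp_lTensor]
    have exS := lTensor_exact S (LinearMap.exact_subtype_mkQ N) N.mkQ_surjective
    have exT := lTensor_exact T (LinearMap.exact_subtype_mkQ N) N.mkQ_surjective
    constructor
    · rw [← LinearMap.ker_eq_bot, LinearMap.ker_eq_bot']
      intro x hx
      have h1 : N.mkQ.lTensor S x = 0 := hQ.1 (by rw [c2, hx, map_zero, map_zero])
      obtain ⟨y, rfl⟩ := (exS x).mp h1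
      have h2 : f.rTensor N y = 0 :=
        Module.Flat.lTensor_preserves_injective_linearMap (M := T) N.subtype N.injective_subtype
          (by rw [← c1, hx, map_zero])
      rw [hN.1 (h2.trans (map_zero _).symm), map_zero]
    · intro z
      obtain ⟨q, hq⟩ := hQ.2 (N.mkQ.lTensor T z)
      obtain ⟨x, rfl⟩ := LinearMap.lTensor_surjective S N.mkQ_surjective q
      obtain ⟨y, hy⟩ := (exT (z - f.rTensor M x)).mp (by rw [map_sub, ← c2, hq, sub_self])
      obtain ⟨w, rfl⟩ := hN.2 y
      exact ⟨x + N.subtype.lTensor S w, by rw [map_add, c1, hy, add_sub_cancel]⟩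

section

variable {R S T : Type*} [CommRing R] [CommRing S] [CommRing T] [Algebra R S] [Algebra S T]
  [Algebra R T] [IsScalarTower R S T]

open TensorProduct in
/-- The map `S ⊗ R/I → T ⊗ R/I` is bijective if and only if `S/IS → T/IT` is. -/
theorem bijective_rTensor_quotient_iff (I : Ideal R) :
    Function.Bijective
      ((IsScalarTower.toAlgHom R S T).toLinearMap.rTensor (R ⧸ I)) ↔
    (∀ s : S, algebraMap S T s ∈ I.map (algebraMap R T) → s ∈ I.map (algebraMap R S)) ∧
    (∀ t : T, ∃ s : S, t - algebraMap S T s ∈ I.map (algebraMap R T)) := by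
  let f := (IsScalarTower.toAlgHom R S T).toLinearMap
  let eS := TensorProduct.tensorQuotEquivQuotSMul S I
  let eT := TensorProduct.tensorQuotEquivQuotSMul T I
  have hS (s : S) : Submodule.Quotient.mk (p := I • (⊤ : Submodule R S)) s = 0 ↔
      s ∈ I.map (algebraMap R S) := by
    rw [Submodule.Quotient.mk_eq_zero, Ideal.smul_top_eq_map]; rfl
  have hT (s : T) : Submodule.Quotient.mk (p := I • (⊤ : Submodule R T)) s = 0 ↔
      s ∈ I.map (algebraMap R T) := by
    rw [Submodule.Quotient.mk_eq_zero, Ideal.smul_top_eq_map]; rfl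
  have c (s : S) : eT (f.rTensor (R ⧸ I) (eS.symm (Submodule.Quotient.mk s))) =
      Submodule.Quotient.mk (algebraMap S T s) := by
    rw [TensorProduct.tensorQuotEquivQuotSMul_symm_mk, LinearMap.rTensor_tmul,
      ← TensorProduct.tensorQuotEquivQuotSMul_symm_mk, LinearEquiv.apply_symm_apply]
    rfl
  have hb : Function.Bijective (f.rTensor (R ⧸ I)) ↔
      Function.Bijective (eT ∘ f.rTensor (R ⧸ I) ∘ eS.symm) := by
    simp
  refine hb.trans (and_congr ⟨fun h s hs ↦ ?_, fun h ↦ ?_⟩ ⟨fun h t ↦ ?_, fun h ↦ ?_⟩)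
  · rw [← hS]
    refine h ?_
    simp only [Function.comp_apply, map_zero]
    rw [c, hT]
    exact hs
  · intro x y hxy
    obtain ⟨x, rfl⟩ := Submodule.Quotient.mk_surjective _ x
    obtain ⟨y, rfl⟩ := Submodule.Quotient.mk_surjective _ y
    simp only [Function.comp_apply, c] at hxy
    rw [← sub_eq_zero, ← Submodule.Quotient.mk_sub, hT, ← map_sub] at hxy
    rw [← sub_eq_zero, ← Submodule.Quotient.mk_sub, hS]
    exact h _ hxy
  · obtain ⟨s, hs⟩ := h (Submodule.Quotient.mk t)
    obtain ⟨s, rfl⟩ := Submodule.Quotient.mk_surjective _ s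
    simp only [Function.comp_apply, c] at hs
    refine ⟨s, ?_⟩
    rw [← hT, Submodule.Quotient.mk_sub, hs, sub_self]
  · intro t
    obtain ⟨t, rfl⟩ := Submodule.Quotient.mk_surjective _ t
    obtain ⟨s, hs⟩ := h t
    refine ⟨Submodule.Quotient.mk s, ?_⟩
    simp only [Function.comp_apply, c]
    rw [← hT, Submodule.Quotient.mk_sub, sub_eq_zero] at hs
    exact hs.symm

open TensorProduct in
/-- A special case of the fibrewise criterion of flatness: if `T` is flat over `R` and `S → T` is
an isomorphism modulo an ideal `I` of `R` which generates an ideal in the Jacobson radical of `T`,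
then `T` is flat over `S`. Indeed `S → T` is then an isomorphism modulo all powers of `I`, and an
element of the kernel of `T ⊗ J → T` lies in `Iⁿ (T ⊗ J)` for all `n` by the Artin-Rees lemma, so
it is zero by Krull's intersection theorem. -/
theorem flat_of_bijective_quotient [IsNoetherianRing S] [IsNoetherianRing T]
    [Module.Flat R T] (I : Ideal R) (hI : I.map (algebraMap R T) ≤ Ideal.jacobson ⊥)
    (hinj : ∀ s : S, algebraMap S T s ∈ I.map (algebraMap R T) → s ∈ I.map (algebraMap R S))
    (hsurj : ∀ t : T, ∃ s : S, t - algebraMap S T s ∈ I.map (algebraMap R T)) :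
    Module.Flat S T := by
  have key (n : ℕ) := (bijective_rTensor_quotient_iff (S := S) (T := T) (I ^ n)).mp
    (bijective_rTensor_of_pow_smul_eq_bot _ I
      ((bijective_rTensor_quotient_iff I).mpr ⟨hinj, hsurj⟩) n (R ⧸ I ^ n) (by
        rw [← Submodule.range_mkQ (I ^ n), ← Submodule.map_top, ← Submodule.map_smul'',
          smul_eq_mul, Ideal.mul_top, Submodule.mkQ_map_self]))
  set a : Ideal S := I.map (algebraMap R S) with ha
  set b : Ideal T := I.map (algebraMap R T) with hb
  have hab (n : ℕ) : (a ^ n).map (algebraMap S T) = b ^ n := by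
    rw [Ideal.map_pow, ha, Ideal.map_map, ← IsScalarTower.algebraMap_eq]
  replace key (n : ℕ) : (∀ s : S, algebraMap S T s ∈ b ^ n → s ∈ a ^ n) ∧
      (∀ t : T, ∃ s : S, t - algebraMap S T s ∈ b ^ n) := by
    simpa only [Ideal.map_pow] using key n
  rw [Module.Flat.iff_lTensor_injective']
  intro J
  rw [← LinearMap.ker_eq_bot, LinearMap.ker_eq_bot']
  intro x hx
  have := Ideal.iInf_pow_smul_eq_bot_of_le_jacobson (M := T ⊗[S] J) b hI
  rw [← Submodule.mem_bot T, ← this, Submodule.mem_iInf]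
  intro n
  obtain ⟨m, hm⟩ := a.exists_pow_inf_eq_pow_smul (M := S) J
  let N := n + m
  let K : Submodule S J := Submodule.comap J.subtype (a ^ N)
  -- an element of `T ⊗ K` has image in `T ⊗ S = T` contained in `b ^ N`
  have hK (z : T ⊗[S] K) :
      TensorProduct.rid S T (J.subtype.lTensor T (K.subtype.lTensor T z)) ∈ b ^ N := by
    induction z with
    | zero => simp
    | add x y hx hy => simpa only [map_add] using add_mem hx hy
    | tmul t j =>
      simp only [LinearMap.lTensor_tmul, TensorProduct.rid_tmul, Algebra.smul_def]
      exact Ideal.mul_mem_right _ _ (hab N ▸ Ideal.mem_map_of_mem _ j.2)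
  -- `J ⧸ K` is killed by `a ^ N`, and `S → T` is surjective modulo `a ^ N`
  have hone (y : T ⊗[S] (J ⧸ K)) : ∃ q, y = 1 ⊗ₜ q := by
    induction y with
    | zero => exact ⟨0, by simp⟩
    | add x y hx hy =>
      obtain ⟨q, rfl⟩ := hx
      obtain ⟨q', rfl⟩ := hy
      exact ⟨q + q', by rw [TensorProduct.tmul_add]⟩
    | tmul t q =>
      obtain ⟨s, hs⟩ := (key N).2 t
      have h0 : ∀ v ∈ b ^ N, v ⊗ₜ[S] q = 0 := by
        intro v hv
        rw [← hab] at hv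
        obtain ⟨q, rfl⟩ := K.mkQ_surjective q
        refine Submodule.span_induction (p := fun v _ ↦ v ⊗ₜ[S] K.mkQ q = 0) ?_ ?_ ?_ ?_ hv
        · rintro _ ⟨c, hc, rfl⟩
          rw [Algebra.algebraMap_eq_smul_one, TensorProduct.smul_tmul, ← map_smul]
          have : c • q ∈ K := Ideal.mul_mem_right _ _ hc
          rw [Submodule.mkQ_apply, (Submodule.Quotient.mk_eq_zero K).mpr this,
            TensorProduct.tmul_zero]
        · exact TensorProduct.zero_tmul _ _
        · intro x y _ _ hx hy
          rw [TensorProduct.add_tmul, hx, hy, add_zero]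
        · intro c x _ hx
          rw [← TensorProduct.smul_tmul', hx, smul_zero]
      refine ⟨s • q, ?_⟩
      have := h0 _ hs
      rwa [TensorProduct.sub_tmul, sub_eq_zero, Algebra.algebraMap_eq_smul_one,
        TensorProduct.smul_tmul] at this
  obtain ⟨q, hq⟩ := hone (K.mkQ.lTensor T x)
  obtain ⟨i, rfl⟩ := K.mkQ_surjective q
  obtain ⟨z, hz⟩ := (lTensor_exact T (LinearMap.exact_subtype_mkQ K) K.mkQ_surjective
    (x - 1 ⊗ₜ i)).mp (by rw [map_sub, hq, LinearMap.lTensor_tmul, sub_self])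
  have hi : i ∈ K := by
    refine (key N).1 _ ?_
    have h1 := hK z
    rw [hz, map_sub, hx, zero_sub, map_neg, neg_mem_iff] at h1
    simpa only [LinearMap.lTensor_tmul, TensorProduct.rid_tmul, Algebra.smul_def, mul_one,
      Submodule.subtype_apply] using h1
  -- Artin-Rees: `K = a ^ N ⊓ J` is contained in `a ^ n J`
  have hKn : K ≤ a ^ n • (⊤ : Submodule S J) := by
    intro j hj
    have h1 : (j : S) ∈ a ^ N • (⊤ : Submodule S S) ⊓ J := by
      refine ⟨?_, j.2⟩
      rw [smul_eq_mul, Ideal.mul_top]; exact hj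
    rw [hm N (Nat.le_add_left _ _)] at h1
    have h2 : (j : S) ∈ a ^ n • J := by
      rw [show N - m = n from Nat.add_sub_cancel n m] at h1
      exact Submodule.smul_mono le_rfl inf_le_right h1
    have h3 : (a ^ n • (⊤ : Submodule S J)).map J.subtype = a ^ n • J := by
      rw [Submodule.map_smul'', Submodule.map_top, Submodule.range_subtype]
    rw [← h3] at h2
    obtain ⟨j', hj', h4⟩ := h2
    rwa [← Subtype.ext (a1 := j') (a2 := j) h4]
  have hsm (t : T) (j : J) (hj : j ∈ a ^ n • (⊤ : Submodule S J)) :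
      t ⊗ₜ[S] j ∈ b ^ n • (⊤ : Submodule T (T ⊗[S] J)) := by
    induction hj using Submodule.smul_induction_on' with
    | smul c hc j hj =>
      rw [TensorProduct.tmul_smul, ← algebraMap_smul T c]
      exact Submodule.smul_mem_smul (hab n ▸ Ideal.mem_map_of_mem _ hc) trivial
    | add x hx y hy h1 h2 =>
      rw [TensorProduct.tmul_add]
      exact add_mem h1 h2
  have hx' : x = K.subtype.lTensor T z + 1 ⊗ₜ i := by rw [hz, sub_add_cancel]
  rw [hx']
  refine add_mem ?_ (hsm 1 i (hKn hi))
  clear hz hx'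
  induction z with
  | zero => simp
  | add x y hx hy => simpa only [map_add] using add_mem hx hy
  | tmul t j => exact hsm t j (hKn j.2)

end

end AutVariety

/-! ### Rational points, reduced closed subschemes and families of automorphisms -/

namespace AutVariety

open TopologicalSpace Topology

section Reduced

variable {X : Scheme.{u}}

/-- The closed subscheme with the vanishing ideal of a closed subset is reduced. -/
instance isReduced_subscheme_vanishingIdeal (Z : Closeds X) :
    IsReduced (Scheme.IdealSheafData.vanishingIdeal Z).subscheme := by
  let I := Scheme.IdealSheafData.vanishingIdeal Z
  have (U : X.affineOpens) : IsReduced (I.subschemeCover.openCover.X U) := by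
    have : _root_.IsReduced (Γ(X, U) ⧸ I.ideal U) :=
      (Ideal.isRadical_iff_quotient_reduced _).mp (PrimeSpectrum.isRadical_vanishingIdeal _)
    exact inferInstanceAs (IsReduced (Spec (.of (Γ(X, U) ⧸ I.ideal U))))
  exact @IsReduced.of_openCover _ I.subschemeCover.openCover this

end Reduced

theorem isIrreducible_image_iff_of_isInducing {P Q : Type*} [TopologicalSpace P]
    [TopologicalSpace Q] {f : P → Q} (hf : IsInducing f) {s : Set P} :
    IsIrreducible (f '' s) ↔ IsIrreducible s := by
  refine ⟨fun h ↦ ⟨h.1.of_image, ?_⟩, fun h ↦ h.image f hf.continuous.continuousOn⟩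
  intro u v hu hv ⟨x, hx, hxu⟩ ⟨y, hy, hyv⟩
  obtain ⟨u, hu', rfl⟩ := hf.isOpen_iff.mp hu
  obtain ⟨v, hv', rfl⟩ := hf.isOpen_iff.mp hv
  obtain ⟨_, ⟨z, hz, rfl⟩, hzu, hzv⟩ :=
    h.2 u v hu' hv' ⟨_, Set.mem_image_of_mem f hx, hxu⟩ ⟨_, Set.mem_image_of_mem f hy, hyv⟩
  exact ⟨z, hz, hzu, hzv⟩

variable {k : Type u} [Field k] {X Y A B : Over (Spec (.of k))}

instance [LocallyOfFiniteType A.hom] [LocallyOfFiniteType X.hom] :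
    LocallyOfFiniteType (A ⊗ X).hom :=
  inferInstanceAs (LocallyOfFiniteType (Limits.pullback.fst A.hom X.hom ≫ A.hom))

instance [QuasiCompact A.hom] [QuasiCompact X.hom] : QuasiCompact (A ⊗ X).hom :=
  inferInstanceAs (QuasiCompact (Limits.pullback.fst A.hom X.hom ≫ A.hom))

instance [IsSeparated A.hom] [IsSeparated X.hom] : IsSeparated (A ⊗ X).hom :=
  inferInstanceAs (IsSeparated (Limits.pullback.fst A.hom X.hom ≫ A.hom))

theorem locallyOfFiniteType_left [LocallyOfFiniteType X.hom] (f : X ⟶ Y) :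
    LocallyOfFiniteType f.left := by
  have : LocallyOfFiniteType (f.left ≫ Y.hom) := by rw [Over.w f]; infer_instance
  exact locallyOfFiniteType_of_comp f.left Y.hom

theorem isLocallyNoetherian_left [LocallyOfFiniteType X.hom] : IsLocallyNoetherian X.left :=
  LocallyOfFiniteType.isLocallyNoetherian X.hom

theorem compactSpace_left [QuasiCompact X.hom] : CompactSpace X.left :=
  (quasiCompact_iff_compactSpace (Y := Spec (.of k)) X.hom).mp inferInstance

theorem isNoetherian_left [LocallyOfFiniteType X.hom] [QuasiCompact X.hom] :
    IsNoetherian X.left where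
  __ := isLocallyNoetherian_left (X := X)
  __ := compactSpace_left (X := X)

theorem jacobsonSpace_left [LocallyOfFiniteType X.hom] : JacobsonSpace X.left :=
  LocallyOfFiniteType.jacobsonSpace X.hom

namespace Points

theorem isInducing_toScheme : IsInducing (toScheme (X := X)) := ⟨rfl⟩

theorem toScheme_comp (x : Points X) (f : X ⟶ Y) : toScheme (x ≫ f) = f.left x.toScheme := rfl

theorem continuous_comp (f : X ⟶ Y) : Continuous fun x : Points X ↦ x ≫ f := by
  rw [isInducing_toScheme.continuous_iff]
  exact f.left.continuous.comp isInducing_toScheme.continuous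

instance : ContinuousConstSMul (Aut X) (Points X) := ⟨fun g ↦ continuous_comp g.hom⟩

variable [IsAlgClosed k]

section

variable [LocallyOfFiniteType X.hom]

theorem toScheme_injective : Function.Injective (toScheme (X := X)) := by
  intro x y h
  have hx : x.left ≫ X.hom = 𝟙 _ := Over.w x
  have hy : y.left ≫ X.hom = 𝟙 _ := Over.w y
  exact Over.OverMorphism.ext (ext_of_apply_closedPoint_eq X.hom hx hy h)

theorem range_toScheme : Set.range (toScheme (X := X)) = closedPoints X.left := by
  ext p
  constructor
  · rintro ⟨x, rfl⟩
    exact (pointEquivClosedPoint X.hom ⟨x.left, Over.w x⟩).2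
  · intro hp
    exact ⟨Over.homMk _ ((pointEquivClosedPoint X.hom).symm ⟨p, hp⟩).2,
      congrArg Subtype.val ((pointEquivClosedPoint X.hom).apply_symm_apply ⟨p, hp⟩)⟩

theorem isClosed_singleton_toScheme (x : Points X) : IsClosed {x.toScheme} := by
  have : x.toScheme ∈ closedPoints X.left := by
    rw [← range_toScheme]; exact Set.mem_range_self x
  exact this

/-- Rational points are dense in every locally closed subset, by Hilbert's Nullstellensatz. -/
theorem exists_toScheme_mem {Z : Set X.left} (hZ : Z.Nonempty) (hZ' : IsLocallyClosed Z) :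
    ∃ x : Points X, x.toScheme ∈ Z := by
  have := jacobsonSpace_left (X := X)
  obtain ⟨p, hp, hp'⟩ := nonempty_inter_closedPoints hZ hZ'
  rw [← range_toScheme] at hp'
  obtain ⟨x, rfl⟩ := hp'
  exact ⟨x, hp⟩

theorem exists_comp_eq {f : X ⟶ Y} [LocallyOfFiniteType Y.hom] {Z : Set X.left}
    (hZ : IsLocallyClosed Z) (y : Points Y) (hy : y.toScheme ∈ f.left '' Z) :
    ∃ x : Points X, x.toScheme ∈ Z ∧ x ≫ f = y := by
  obtain ⟨p, hp, hpy⟩ := hy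
  have h : IsLocallyClosed (Z ∩ f.left ⁻¹' {y.toScheme}) :=
    hZ.inter ((isClosed_singleton_toScheme y).preimage f.left.continuous).isLocallyClosed
  obtain ⟨x, hx, hx'⟩ := exists_toScheme_mem (Z := Z ∩ f.left ⁻¹' {y.toScheme}) ⟨p, hp, hpy⟩ h
  exact ⟨x, hx, toScheme_injective hx'⟩

theorem closure_toScheme_image_preimage {Z : Set X.left} (hZ : IsLocallyClosed Z) :
    closure (toScheme '' (toScheme ⁻¹' Z : Set (Points X))) = closure Z := by
  have := jacobsonSpace_left (X := X)
  rw [Set.image_preimage_eq_inter_range, range_toScheme,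
    JacobsonSpace.closure_inter_closedPoints_eq_closure hZ]

theorem isIrreducible_preimage_iff {Z : Set X.left} (hZ : IsLocallyClosed Z) :
    IsIrreducible (toScheme ⁻¹' Z : Set (Points X)) ↔ IsIrreducible Z := by
  rw [← isIrreducible_iff_closure (s := Z), ← closure_toScheme_image_preimage hZ,
    isIrreducible_iff_closure, isIrreducible_image_iff_of_isInducing isInducing_toScheme]

theorem irreducibleSpace_iff : IrreducibleSpace (Points X) ↔ IrreducibleSpace X.left := by
  have := isIrreducible_preimage_iff (X := X) (Z := Set.univ) isOpen_univ.isLocallyClosed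
  rw [Set.preimage_univ] at this
  exact (irreducibleSpace_def _).trans (this.trans (irreducibleSpace_def _).symm)

instance [QuasiCompact X.hom] : NoetherianSpace (Points X) := by
  have := isNoetherian_left (X := X)
  exact isInducing_toScheme.noetherianSpace

/-- Two morphisms from a reduced scheme to a separated one agree if they do on points. -/
theorem hom_ext [IsReduced X.left] [IsSeparated Y.hom] [LocallyOfFiniteType Y.hom] {f g : X ⟶ Y}
    (h : ∀ x : Points X, x ≫ f = x ≫ g) : f = g := by
  apply Over.OverMorphism.ext
  have : LocallyOfFiniteType (f.left ≫ Y.hom) := by rw [Over.w f]; infer_instance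
  refine ext_of_apply_eq Y.hom Set.univ isOpen_univ.isLocallyClosed dense_univ ?_
    ((Over.w f).trans (Over.w g).symm)
  intro p _ hp
  have hp' : p ∈ closedPoints X.left := hp
  rw [← range_toScheme] at hp'
  obtain ⟨x, rfl⟩ := hp'
  exact congrArg toScheme (h x)

end

/-- Images of closed sets under morphisms are constructible, by Chevalley's theorem. -/
theorem exists_isConstructible_image [LocallyOfFiniteType X.hom] [QuasiCompact X.hom]
    [LocallyOfFiniteType Y.hom] [QuasiCompact Y.hom] (f : X ⟶ Y) {Z : Set (Points X)}
    (hZ : IsClosed Z) :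
    ∃ s : Set Y.left, IsConstructible s ∧ toScheme ⁻¹' s = (fun x : Points X ↦ x ≫ f) '' Z := by
  obtain ⟨W, hW, rfl⟩ := isInducing_toScheme.isClosed_iff.mp hZ
  have := isNoetherian_left (X := X)
  have := isNoetherian_left (X := Y)
  have := locallyOfFiniteType_left f
  have hWc : IsConstructible W :=
    ((NoetherianSpace.isCompact Wᶜ).isConstructible hW.isOpen_compl).of_compl
  refine ⟨f.left '' W, f.left.isConstructible_image hWc, ?_⟩
  ext y
  constructor
  · intro hy
    obtain ⟨x, hx, hxy⟩ := exists_comp_eq hW.isLocallyClosed y hy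
    exact ⟨x, hx, hxy⟩
  · rintro ⟨x, hx, rfl⟩
    exact ⟨_, hx, rfl⟩

theorem containsOpenOfClosure_image [LocallyOfFiniteType X.hom] [QuasiCompact X.hom]
    [LocallyOfFiniteType Y.hom] [QuasiCompact Y.hom] (f : X ⟶ Y) {Z : Set (Points X)}
    (hZ : IsClosed Z) (hZ' : IsIrreducible Z) :
    ContainsOpenOfClosure ((fun x : Points X ↦ x ≫ f) '' Z) := by
  obtain ⟨s, hs, h⟩ := exists_isConstructible_image f hZ
  have := hZ'.image _ (continuous_comp f).continuousOn
  rw [← h] at this ⊢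
  exact containsOpenOfClosure_preimage isInducing_toScheme.continuous hs this

end Points

/-- The reduced closed subscheme of `X` on a closed subset `Z`. -/
noncomputable def reducedClosed (Z : Closeds X.left) : Over (Spec (.of k)) :=
  Over.mk ((Scheme.IdealSheafData.vanishingIdeal Z).subschemeι ≫ X.hom)

/-- The inclusion of the reduced closed subscheme on a closed subset. -/
noncomputable def reducedClosedHom (Z : Closeds X.left) : reducedClosed Z ⟶ X :=
  Over.homMk (Scheme.IdealSheafData.vanishingIdeal Z).subschemeι rfl

section reducedClosed

variable (Z : Closeds X.left)

instance : IsClosedImmersion (reducedClosedHom Z).left :=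
  inferInstanceAs (IsClosedImmersion (Scheme.IdealSheafData.vanishingIdeal Z).subschemeι)

instance : IsReduced (reducedClosed Z).left :=
  isReduced_subscheme_vanishingIdeal Z

instance [LocallyOfFiniteType X.hom] : LocallyOfFiniteType (reducedClosed Z).hom :=
  inferInstanceAs
    (LocallyOfFiniteType ((Scheme.IdealSheafData.vanishingIdeal Z).subschemeι ≫ X.hom))

instance [QuasiCompact X.hom] : QuasiCompact (reducedClosed Z).hom :=
  inferInstanceAs (QuasiCompact ((Scheme.IdealSheafData.vanishingIdeal Z).subschemeι ≫ X.hom))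

instance [IsSeparated X.hom] : IsSeparated (reducedClosed Z).hom :=
  inferInstanceAs (IsSeparated ((Scheme.IdealSheafData.vanishingIdeal Z).subschemeι ≫ X.hom))

theorem range_reducedClosedHom : Set.range (reducedClosedHom Z).left = Z := by
  refine (Scheme.IdealSheafData.range_subschemeι _).trans ?_
  simp

theorem irreducibleSpace_reducedClosed (hZ : IsIrreducible (Z : Set X.left)) :
    IrreducibleSpace (reducedClosed Z).left := by
  rw [irreducibleSpace_def, ← isIrreducible_image_iff_of_isInducing
    (reducedClosedHom Z).left.isEmbedding.isInducing]
  convert hZ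
  exact Set.image_univ.trans (range_reducedClosedHom Z)

theorem Points.range_comp_reducedClosedHom [IsAlgClosed k] [LocallyOfFiniteType X.hom] :
    (Set.range fun x : Points (reducedClosed Z) ↦ x ≫ reducedClosedHom Z) =
      toScheme ⁻¹' (Z : Set X.left) := by
  ext y
  constructor
  · rintro ⟨x, rfl⟩
    rw [← range_reducedClosedHom]
    exact Set.mem_range_self (f := (reducedClosedHom Z).left) x.toScheme
  · intro hy
    obtain ⟨x, -, hx⟩ := exists_comp_eq (f := reducedClosedHom Z) (Z := Set.univ)
      isOpen_univ.isLocallyClosed y (by rw [Set.image_univ, range_reducedClosedHom]; exact hy)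
    exact ⟨x, hx⟩

end reducedClosed

theorem comp_whiskerRight_lift (i : B ⟶ A) (b : Points B) (x : Points X) :
    lift b x ≫ (i ▷ X) = lift (b ≫ i) x := by
  simp

theorem lift_comp_fst_snd (p : Points (A ⊗ X)) : lift (p ≫ fst A X) (p ≫ snd A X) = p := by
  simp

theorem lift_eq_comp_right (a : Points A) (x : Points X) :
    lift a x = x ≫ lift (toUnit X ≫ a) (𝟙 X) := by
  simp [comp_lift]

theorem lift_eq_comp_left (a : Points A) (x : Points X) :
    lift a x = a ≫ lift (𝟙 A) (toUnit A ≫ x) := by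
  simp [comp_lift]

theorem IsMorphism.comp {ρ : Points A → Aut X} (h : IsMorphism ρ) (i : B ⟶ A) :
    IsMorphism fun b ↦ ρ (b ≫ i) := by
  obtain ⟨φ, hφ⟩ := h
  exact ⟨(i ▷ X) ≫ φ, fun b x ↦ by rw [← hφ, ← comp_whiskerRight_lift, Category.assoc]⟩

theorem IsMorphism.mul {ρ : Points A → Aut X} {σ : Points B → Aut X} (hρ : IsMorphism ρ)
    (hσ : IsMorphism σ) :
    IsMorphism fun p : Points (A ⊗ B) ↦ ρ (p ≫ fst A B) * σ (p ≫ snd A B) := by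
  obtain ⟨φ, hφ⟩ := hρ
  obtain ⟨ψ, hψ⟩ := hσ
  refine ⟨lift (fst _ _ ≫ fst _ _) (lift (fst _ _ ≫ snd _ _) (snd _ _) ≫ ψ) ≫ φ, fun p x ↦ ?_⟩
  rw [mul_smul, ← hψ, ← hφ, ← Category.assoc, comp_lift, ← Category.assoc, lift_fst,
    ← Category.assoc (lift p x), comp_lift, ← Category.assoc, lift_fst, lift_snd]

theorem range_mul_range (ρ : Points A → Aut X) (σ : Points B → Aut X) :
    (Set.range fun p : Points (A ⊗ B) ↦ ρ (p ≫ fst A B) * σ (p ≫ snd A B)) =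
      Set.range ρ * Set.range σ := by
  ext g
  constructor
  · rintro ⟨p, rfl⟩
    exact Set.mul_mem_mul ⟨_, rfl⟩ ⟨_, rfl⟩
  · rintro ⟨_, ⟨a, rfl⟩, _, ⟨b, rfl⟩, rfl⟩
    exact ⟨lift a b, by simp⟩

theorem Points.image2_lift {Z : Set (Points X)} :
    Set.image2 (fun (a : Points A) x ↦ lift a x) Set.univ Z =
      (fun p : Points (A ⊗ X) ↦ p ≫ snd A X) ⁻¹' Z := by
  ext p
  constructor
  · rintro ⟨a, -, x, hx, rfl⟩
    simpa using hx
  · intro hp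
    exact ⟨p ≫ fst A X, trivial, p ≫ snd A X, hp, lift_comp_fst_snd p⟩

/-- For `Z = X` this is the irreducibility of a product of irreducible varieties. -/
theorem Points.isIrreducible_preimage_snd [IrreducibleSpace (Points A)] {Z : Set (Points X)}
    (hZ : IsIrreducible Z) :
    IsIrreducible ((fun p : Points (A ⊗ X) ↦ p ≫ snd A X) ⁻¹' Z) := by
  rw [← image2_lift]
  refine isIrreducible_image2 hZ (fun (a : Points A) x ↦ lift a x) (fun x ↦ ?_) (fun a ↦ ?_)
  · simp only [lift_eq_comp_left]
    exact continuous_comp _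
  · simp only [lift_eq_comp_right]
    exact continuous_comp _

instance [IrreducibleSpace (Points A)] [IrreducibleSpace (Points X)] :
    IrreducibleSpace (Points (A ⊗ X)) := by
  rw [irreducibleSpace_def]
  exact Points.isIrreducible_preimage_snd (IrreducibleSpace.isIrreducible_univ (Points X))

/-- The source of the family need not be reduced, since it can be replaced by its reduction. -/
theorem IsMorphism.isIrreducibleConstructible [IsAlgClosed k] [LocallyOfFiniteType A.hom]
    [QuasiCompact A.hom] [IsSeparated A.hom] [IrreducibleSpace (Points A)] {ρ : Points A → Aut X}
    (h : IsMorphism ρ) :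
    IsIrreducibleConstructible (Set.range ρ) := by
  have hA : IrreducibleSpace A.left := Points.irreducibleSpace_iff.mp inferInstance
  refine ⟨reducedClosed (X := A) ⊤, ⟨⟨inferInstance, inferInstance, inferInstance, inferInstance⟩,
    irreducibleSpace_reducedClosed _ (IrreducibleSpace.isIrreducible_univ A.left)⟩,
    _, h.comp (reducedClosedHom ⊤), ?_⟩
  have h1 : Set.range (fun x : Points (reducedClosed (X := A) ⊤) ↦ x ≫ reducedClosedHom ⊤) =
      Set.univ := Points.range_comp_reducedClosedHom _
  rw [← Set.image_univ (f := ρ), ← h1, ← Set.range_comp]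
  rfl

theorem IsIrreducibleConstructible.mul [IsAlgClosed k] {V W : Set (Aut X)}
    (hV : IsIrreducibleConstructible V) (hW : IsIrreducibleConstructible W) :
    IsIrreducibleConstructible (V * W) := by
  obtain ⟨A, ⟨⟨_, _, _, _⟩, hA⟩, ρ, hρ, rfl⟩ := hV
  obtain ⟨B, ⟨⟨_, _, _, _⟩, hB⟩, σ, hσ, rfl⟩ := hW
  rw [← Points.irreducibleSpace_iff] at hA hB
  rw [← range_mul_range]
  exact (hρ.mul hσ).isIrreducibleConstructible

end AutVariety

/-! ### Families of inverses -/

namespace AutVariety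

open TopologicalSpace Topology IsLocalRing

section ClosedPoints

variable {X Y : Scheme.{u}}

theorem exists_primeIdealOf_eq [JacobsonSpace X] {V : X.Opens} (hV : IsAffineOpen V)
    (q : PrimeSpectrum Γ(X, V)) (hq : q.asIdeal.IsMaximal) :
    ∃ (x : X) (hx : x ∈ V), IsClosed {x} ∧ hV.primeIdealOf ⟨x, hx⟩ = q := by
  have hx : hV.fromSpec q ∈ V := by
    have := Set.mem_range_self (f := hV.fromSpec) q
    rwa [hV.range_fromSpec] at this
  refine ⟨hV.fromSpec q, hx, ?_,
    hV.fromSpec.isOpenEmbedding.injective (hV.fromSpec_primeIdealOf ⟨_, hx⟩)⟩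
  have h1 : q ∈ closedPoints (Spec Γ(X, V)) := q.isClosed_singleton_iff_isMaximal.mpr hq
  rw [← hV.fromSpec.isOpenEmbedding.preimage_closedPoints] at h1
  exact h1

/-- Flatness of a morphism to or from a Jacobson scheme can be checked at closed points. -/
theorem flat_of_forall_isClosed [JacobsonSpace X] (f : X ⟶ Y)
    (H : ∀ x : X, IsClosed {x} → (f.stalkMap x).hom.Flat) : Flat f := by
  rw [flat_iff]
  intro U hU V hV hVU
  algebraize [(f.appLE U V hVU).hom]
  refine Module.flat_of_isLocalized_maximal (R := Γ(Y, U)) (S := Γ(X, V)) Γ(X, V)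
    (fun P _ ↦ Localization.AtPrime P)
    (fun P _ ↦ Algebra.linearMap Γ(X, V) (Localization.AtPrime P)) fun q hq ↦ ?_
  obtain ⟨x, hx, hxc, h⟩ := exists_primeIdealOf_eq hV ⟨q, hq.isPrime⟩ hq
  obtain rfl : (hV.primeIdealOf ⟨x, hx⟩).asIdeal = q := congrArg PrimeSpectrum.asIdeal h
  let p := (hU.primeIdealOf ⟨f x, hVU hx⟩).asIdeal
  let q := (hV.primeIdealOf ⟨x, hx⟩).asIdeal
  have : q.LiesOver p :=
    ⟨congr($(IsAffineOpen.comap_primeIdealOf_appLE U hU V hV hVU hx).1).symm⟩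
  let := Localization.AtPrime.algebraOfLiesOver p q
  have : Module.Flat (Localization.AtPrime p) (Localization.AtPrime q) := by
    rw [← RingHom.flat_algebraMap_iff]
    exact (RingHom.Flat.respectsIso.arrow_mk_iso_iff
      (IsAffineOpen.arrowStalkMapIso f U hU V hV hVU hx)).mp (H x hxc)
  exact Module.Flat.trans Γ(Y, U) (Localization.AtPrime p) (Localization.AtPrime q)

theorem formallyUnramified_of_forall_isClosed [JacobsonSpace X] (f : X ⟶ Y)
    [LocallyOfFiniteType f]
    (H : ∀ x : X, IsClosed {x} → (f.stalkMap x).hom.FormallyUnramified) :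
    FormallyUnramified f := by
  rw [formallyUnramified_iff]
  intro U hU V hV hVU
  have := f.finiteType_appLE hU hV hVU
  algebraize [(f.appLE U V hVU).hom]
  refine Algebra.formallyUnramified_iff_forall.mpr fun q' ↦ ?_
  obtain ⟨m, hm, hqm⟩ := Ideal.exists_le_maximal _ q'.2.ne_top
  obtain ⟨x, hx, hxc, h⟩ := exists_primeIdealOf_eq hV ⟨m, hm.isPrime⟩ hm
  obtain rfl : (hV.primeIdealOf ⟨x, hx⟩).asIdeal = m := congrArg PrimeSpectrum.asIdeal h
  let p := (hU.primeIdealOf ⟨f x, hVU hx⟩).asIdeal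
  let q := (hV.primeIdealOf ⟨x, hx⟩).asIdeal
  have : q.LiesOver p :=
    ⟨congr($(IsAffineOpen.comap_primeIdealOf_appLE U hU V hV hVU hx).1).symm⟩
  let := Localization.AtPrime.algebraOfLiesOver p q
  have : Algebra.FormallyUnramified (Localization.AtPrime p) (Localization.AtPrime q) := by
    rw [← RingHom.formallyUnramified_algebraMap]
    exact (RingHom.FormallyUnramified.respectsIso.arrow_mk_iso_iff
      (IsAffineOpen.arrowStalkMapIso f U hU V hV hVU hx)).mp (H x hxc)
  have h1 : Algebra.FormallyUnramified Γ(Y, U) (Localization.AtPrime p) :=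
    Algebra.FormallyUnramified.of_isLocalization p.primeCompl
  have h2 : hV.primeIdealOf ⟨x, hx⟩ ∈ Algebra.unramifiedLocus Γ(Y, U) Γ(X, V) :=
    Algebra.FormallyUnramified.comp Γ(Y, U) (Localization.AtPrime p) (Localization.AtPrime q)
  exact ((PrimeSpectrum.le_iff_specializes _ _).mp hqm).mem_open
    Algebra.isOpen_unramifiedLocus h2

end ClosedPoints

section Slices

variable {k : Type u} [Field k] {X Y A B : Over (Spec (.of k))}

theorem fromSpecResidueField_eq_comp [IsAlgClosed k] [LocallyOfFiniteType A.hom] (a : Points A) :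
    ∃ g, A.left.fromSpecResidueField a.toScheme = g ≫ a.left := by
  have ha := Points.isClosed_singleton_toScheme a
  refine ⟨Spec.map (residueFieldIsoBase A.hom a.toScheme ha).inv, ?_⟩
  have : a.left = pointOfClosedPoint A.hom a.toScheme ha :=
    ext_of_apply_closedPoint_eq A.hom (Over.w a) (pointOfClosedPoint_comp A.hom _ ha)
      (pointOfClosedPoint_apply A.hom _ ha _).symm
  rw [this, pointOfClosedPoint, ← Category.assoc, ← Spec.map_comp, Iso.hom_inv_id, Spec.map_id,
    Category.id_comp]

theorem SpecMap_comp_fromSpecStalk_closedPoint {X : Scheme.{u}} {x : X} {R : CommRingCat.{u}}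
    [IsLocalRing R] (f : X.presheaf.stalk x ⟶ R) [IsLocalHom f.hom] :
    (Spec.map f ≫ X.fromSpecStalk x) (closedPoint R) = x := by
  refine (Scheme.Hom.comp_apply (Spec.map f) (X.fromSpecStalk x) (closedPoint R)).trans ?_
  exact (congrArg _ Spec_closedPoint).trans Scheme.fromSpecStalk_closedPoint

theorem stalkMap_eq_zero_of_mem_maximalIdeal_of_field {A : Scheme.{u}} (a : Spec (.of k) ⟶ A)
    (z : Spec (.of k)) {s : A.presheaf.stalk (a z)}
    (hs : s ∈ maximalIdeal (A.presheaf.stalk (a z))) : a.stalkMap z s = 0 := by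
  obtain rfl : z = closedPoint k := Subsingleton.elim _ _
  apply (stalkClosedPointIso (.of k)).commRingCatIsoToRingEquiv.injective
  rw [map_zero]
  by_contra hne
  have h2 : IsUnit ((Scheme.stalkClosedPointTo (R := .of k) a).hom s) := IsUnit.mk0 _ hne
  exact (mem_maximalIdeal _).mp hs (isUnit_of_map_unit _ _ h2)

/-- A morphism `X ⟶ A` constant with value a rational point kills the maximal ideals of the
local rings of `A`. -/
theorem stalkMap_eq_zero_of_mem_maximalIdeal {A X : Scheme.{u}} (a : Spec (.of k) ⟶ A)
    {f : X ⟶ A} {h : X ⟶ Spec (.of k)} (hf : f = h ≫ a) (x : X) {s : A.presheaf.stalk (f x)}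
    (hs : s ∈ maximalIdeal (A.presheaf.stalk (f x))) : f.stalkMap x s = 0 := by
  subst hf
  have h1 : a.stalkMap (h x) s = 0 := stalkMap_eq_zero_of_mem_maximalIdeal_of_field a (h x) hs
  rw [Scheme.Hom.stalkMap_comp]
  exact (congrArg (h.stalkMap x) h1).trans (map_zero _)

/-- Let `i : Y ⟶ A × X` identify `Y` with the slice `{a} × X`. Then the local homomorphisms of `i`
are surjective, and their kernels are generated by the maximal ideal of the local ring of `A` at
`a`. For the latter, the closed subscheme of `Spec 𝒪` defined by the maximal ideal at `a`, where
`𝒪` is the local ring of `A × X`, factors through the slice. -/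
theorem stalkMap_slice [IsAlgClosed k] [LocallyOfFiniteType A.hom] {p : A ⊗ X ⟶ A}
    (hp : p = fst A X) (a : Points A) {i : Y ⟶ A ⊗ X} (hi : i ≫ fst A X = toUnit Y ≫ a)
    [IsIso (i ≫ snd A X)] (y : Y.left) :
    Function.Surjective (i.left.stalkMap y) ∧
    RingHom.ker (i.left.stalkMap y).hom =
      (maximalIdeal (A.left.presheaf.stalk (p.left (i.left y)))).map
        (p.left.stalkMap (i.left y)).hom := by
  subst hp
  have hiso : IsIso (i.left ≫ (snd A X).left) := by
    exact inferInstanceAs (IsIso ((Over.forget _).map (i ≫ snd A X)))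
  have hipl : i.left ≫ (fst A X).left = (toUnit Y).left ≫ a.left := by
    rw [← Over.comp_left, hi, Over.comp_left]
  have hinj : Function.Injective i.left := by
    have : Function.Injective (i.left ≫ (snd A X).left) :=
      (i.left ≫ (snd A X).left).homeomorph.injective
    rw [Scheme.Hom.comp_base, TopCat.coe_comp] at this
    exact this.of_comp
  refine ⟨?_, le_antisymm ?_ ?_⟩
  · have : Function.Surjective ((i.left ≫ (snd A X).left).stalkMap y) :=
      (ConcreteCategory.bijective_of_isIso _).2
    rw [Scheme.Hom.stalkMap_comp] at this
    exact Function.Surjective.of_comp this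
  · let O := (A ⊗ X).left.presheaf.stalk (i.left y)
    let J : Ideal O := (maximalIdeal (A.left.presheaf.stalk ((fst A X).left (i.left y)))).map
        ((fst A X).left.stalkMap (i.left y)).hom
    have hJ : J ≤ maximalIdeal O :=
      map_maximalIdeal_le ((fst A X).left.stalkMap (i.left y)).hom
    have hJ' : J ≠ ⊤ := fun h ↦ (maximalIdeal.isMaximal O).ne_top (top_le_iff.mp (h ▸ hJ))
    have : Nontrivial (O ⧸ J) := Ideal.Quotient.nontrivial_iff.mpr hJ'
    have : IsLocalRing (O ⧸ J) := .of_surjective' _ Ideal.Quotient.mk_surjective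
    let π : O ⟶ .of (O ⧸ J) := CommRingCat.ofHom (Ideal.Quotient.mk J)
    have hπ : IsLocalHom π.hom := .of_surjective _ Ideal.Quotient.mk_surjective
    let w' := Spec.map π ≫ (A ⊗ X).left.fromSpecStalk (i.left y)
    let W : Over (Spec (.of k)) := Over.mk (w' ≫ (A ⊗ X).hom)
    let w : W ⟶ A ⊗ X := Over.homMk w' rfl
    have hw : w ≫ fst A X = toUnit W ≫ a := by
      have ha : (fst A X).left (i.left y) = a.toScheme := by
        refine (congrArg (fun f : Y.left ⟶ A.left ↦ f y) hipl).trans ?_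
        exact congrArg a.left (Subsingleton.elim (α := Spec (.of k)) _ _)
      have hb := fromSpecResidueField_eq_comp a
      rw [← ha] at hb
      obtain ⟨g, hg⟩ := hb
      obtain ⟨τ, hτ⟩ : ∃ τ, (fst A X).left.stalkMap (i.left y) ≫ π = A.left.residue _ ≫ τ := by
        refine ⟨CommRingCat.ofHom (Ideal.Quotient.lift _
          ((fst A X).left.stalkMap (i.left y) ≫ π).hom fun s hs ↦ ?_), rfl⟩
        exact Ideal.Quotient.eq_zero_iff_mem.mpr (Ideal.mem_map_of_mem _ hs)
      have h1 : w' ≫ (fst A X).left = (Spec.map τ ≫ g) ≫ a.left := by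
        rw [Category.assoc (Spec.map τ), ← hg, Category.assoc,
          ← Scheme.SpecMap_stalkMap_fromSpecStalk,
          ← Category.assoc, ← Spec.map_comp, hτ, Spec.map_comp, Category.assoc]
        rfl
      have h2 : W.hom = Spec.map τ ≫ g := by
        have h3 : W.hom = (w' ≫ (fst A X).left) ≫ A.hom := by
          rw [Category.assoc, Over.w (fst A X)]; rfl
        rw [h3, h1, Category.assoc, Over.w a]
        exact Category.comp_id _
      apply Over.OverMorphism.ext
      refine h1.trans ?_
      rw [← h2, Over.comp_left, ← Over.w (toUnit W)]
      exact congrArg (· ≫ a.left) (Category.comp_id _)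
    let v : W ⟶ Y := w ≫ snd A X ≫ inv (i ≫ snd A X)
    have hv : v ≫ i = w := by
      apply CartesianMonoidalCategory.hom_ext
      · rw [Category.assoc, hi, hw, ← Category.assoc, toUnit_unique (v ≫ toUnit Y) (toUnit W)]
      · simp [v]
    have hvl : v.left ≫ i.left = w' := by rw [← Over.comp_left, hv]; rfl
    have hvy : v.left (closedPoint (O ⧸ J)) = y := by
      apply hinj
      have h1 : w' (closedPoint (O ⧸ J)) = i.left y :=
        SpecMap_comp_fromSpecStalk_closedPoint π
      exact (congrArg (fun f : Spec (.of (O ⧸ J)) ⟶ _ ↦ f (closedPoint (O ⧸ J))) hvl).trans h1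
    have hfac : ∃ θ : Y.left.presheaf.stalk y ⟶ .of (O ⧸ J),
        v.left = Spec.map θ ≫ Y.left.fromSpecStalk y := by
      have := Scheme.Spec_stalkClosedPointTo_fromSpecStalk (R := .of (O ⧸ J)) v.left
      rw [← hvy]
      exact ⟨_, this.symm⟩
    obtain ⟨θ, hθ⟩ := hfac
    have : π = i.left.stalkMap y ≫ θ := by
      apply Spec.map_injective
      rw [← cancel_mono ((A ⊗ X).left.fromSpecStalk (i.left y)), Spec.map_comp, Category.assoc,
        Scheme.SpecMap_stalkMap_fromSpecStalk, ← Category.assoc, ← hθ, hvl]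
    intro s hs
    rw [RingHom.mem_ker] at hs
    rw [← Ideal.Quotient.eq_zero_iff_mem]
    change π.hom s = 0
    rw [this, CommRingCat.hom_comp, RingHom.comp_apply, hs, map_zero]
  · rw [Ideal.map_le_iff_le_comap]
    intro s hs
    have := stalkMap_eq_zero_of_mem_maximalIdeal a.left hipl y hs
    rw [Scheme.Hom.stalkMap_comp] at this
    exact this

end Slices

theorem isSeparable_of_surjective {K L : Type*} [Field K] [Field L] [Algebra K L]
    (h : Function.Surjective (algebraMap K L)) : Algebra.IsSeparable K L :=
  AlgEquiv.Algebra.isSeparable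
    (AlgEquiv.ofBijective (Algebra.ofId K L) ⟨(algebraMap K L).injective, h⟩)

/-- Let `S → T` be an isomorphism modulo the maximal ideal of `R`. If `T` is flat over `R`, then
`S → T` is étale. -/
theorem flat_and_formallyUnramified_of_bijective_quotient {R S T : Type*} [CommRing R]
    [CommRing S] [CommRing T] [IsLocalRing R] [IsLocalRing S] [IsLocalRing T]
    [IsNoetherianRing S] [IsNoetherianRing T] (α : R →+* S) (f : S →+* T) [IsLocalHom α]
    [IsLocalHom f] (hfin : f.EssFiniteType) (hflat : (f.comp α).Flat)
    (hinj : ∀ s, f s ∈ (maximalIdeal R).map (f.comp α) → s ∈ (maximalIdeal R).map α)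
    (hsurj : ∀ t, ∃ s, t - f s ∈ (maximalIdeal R).map (f.comp α)) :
    f.Flat ∧ f.FormallyUnramified := by
  algebraize [α, f, f.comp α]
  have : IsLocalHom (algebraMap S T) := ‹IsLocalHom f›
  have : IsLocalHom (f.comp α) := RingHom.isLocalHom_comp f α
  have hle : (maximalIdeal R).map (f.comp α) ≤ maximalIdeal T := map_maximalIdeal_le _
  refine ⟨flat_of_bijective_quotient (maximalIdeal R)
    (hle.trans (maximalIdeal_le_jacobson _)) hinj hsurj, ?_⟩
  have hsep : Algebra.IsSeparable (ResidueField S) (ResidueField T) := by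
    refine isSeparable_of_surjective fun z ↦ ?_
    obtain ⟨t, rfl⟩ := residue_surjective z
    obtain ⟨s, hs⟩ := hsurj t
    refine ⟨residue S s, ?_⟩
    have := residue_eq_zero_iff _ |>.mpr (hle hs)
    rw [map_sub, sub_eq_zero] at this
    exact this.symm
  have hm : (maximalIdeal S).map (algebraMap S T) = maximalIdeal T := by
    refine le_antisymm (map_maximalIdeal_le f) fun t ht ↦ ?_
    obtain ⟨s, hs⟩ := hsurj t
    have h1 : f s ∈ maximalIdeal T := by
      have := sub_mem ht (hle hs)
      rwa [sub_sub_cancel] at this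
    have h2 : s ∈ maximalIdeal S := by
      rwa [← maximalIdeal_comap f]
    have h3 : (maximalIdeal R).map (f.comp α) ≤ (maximalIdeal S).map f := by
      rw [← Ideal.map_map]
      exact Ideal.map_mono (map_maximalIdeal_le α)
    rw [← sub_add_cancel t (f s)]
    exact add_mem (h3 hs) (Ideal.mem_map_of_mem _ h2)
  exact Algebra.FormallyUnramified.of_map_maximalIdeal hm

section Inverse

variable {k : Type u} [Field k] [IsAlgClosed k] {X A : Over (Spec (.of k))}
  [LocallyOfFiniteType A.hom] [LocallyOfFiniteType X.hom]

/-- An endomorphism of `A × X` over `A` which is an automorphism of the slices over all points of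
`A` is étale. -/
theorem flat_and_formallyUnramified_of_slices (Φ : A ⊗ X ⟶ A ⊗ X) (hΦ : Φ ≫ fst A X = fst A X)
    (h : ∀ a : Points A, IsIso (lift (toUnit X ≫ a) (𝟙 X) ≫ Φ ≫ snd A X)) :
    Flat Φ.left ∧ FormallyUnramified Φ.left := by
  have key : ∀ y : (A ⊗ X).left, IsClosed {y} →
      (Φ.left.stalkMap y).hom.Flat ∧ (Φ.left.stalkMap y).hom.FormallyUnramified := by
    intro y hy
    obtain ⟨P, rfl⟩ : y ∈ Set.range Points.toScheme := by
      rw [Points.range_toScheme]; exact hy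
    let a := P ≫ fst A X
    let x := Points.toScheme (P ≫ snd A X)
    let j := lift (toUnit X ≫ a) (𝟙 X)
    have hP : P.toScheme = j.left x := by
      rw [← lift_comp_fst_snd P, lift_eq_comp_right]
      rfl
    rw [hP]
    have hj : j ≫ fst A X = toUnit X ≫ a := lift_fst _ _
    have : IsIso (j ≫ snd A X) := by rw [lift_snd]; infer_instance
    have : IsIso ((j ≫ Φ) ≫ snd A X) := by rw [Category.assoc]; exact h a
    obtain ⟨-, kerT⟩ := stalkMap_slice (p := Φ ≫ fst A X) hΦ a hj x
    obtain ⟨surjS, kerS⟩ := stalkMap_slice (p := fst A X) (i := j ≫ Φ) rfl a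
      (by rw [Category.assoc, hΦ, hj]) x
    have eT : (Φ ≫ fst A X).left.stalkMap (j.left x) =
      (fst A X).left.stalkMap (Φ.left (j.left x)) ≫ Φ.left.stalkMap (j.left x) :=
      Scheme.Hom.stalkMap_comp _ _ _
    have eS : (j ≫ Φ).left.stalkMap x =
      Φ.left.stalkMap (j.left x) ≫ j.left.stalkMap x :=
      Scheme.Hom.stalkMap_comp _ _ _
    rw [eT] at kerT
    rw [eS] at surjS kerS
    have := isLocallyNoetherian_left (X := A ⊗ X)
    have hflat : ((Φ ≫ fst A X).left.stalkMap (j.left x)).hom.Flat := by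
      have : Flat (Φ ≫ fst A X).left := by
        rw [hΦ]
        exact inferInstanceAs (Flat (Limits.pullback.fst A.hom X.hom))
      exact Flat.stalkMap _ _
    rw [eT] at hflat
    have := locallyOfFiniteType_left Φ
    refine flat_and_formallyUnramified_of_bijective_quotient
      ((fst A X).left.stalkMap (Φ.left (j.left x))).hom (Φ.left.stalkMap (j.left x)).hom
      (LocallyOfFiniteType.stalkMap _ _) hflat ?_ ?_
    · intro s hs
      refine kerS.le ?_
      have : (Φ.left.stalkMap (j.left x)).hom s ∈ RingHom.ker (j.left.stalkMap x).hom := kerT.ge hs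
      exact this
    · intro t
      obtain ⟨s, hs⟩ := surjS (j.left.stalkMap x t)
      refine ⟨s, kerT.le ?_⟩
      rw [RingHom.sub_mem_ker_iff]
      exact hs.symm
  have := jacobsonSpace_left (X := A ⊗ X)
  have := locallyOfFiniteType_left Φ
  exact ⟨flat_of_forall_isClosed _ fun y hy ↦ (key y hy).1,
    formallyUnramified_of_forall_isClosed _ fun y hy ↦ (key y hy).2⟩

/-- An unramified morphism which is injective on rational points is a monomorphism: its diagonal is
an open immersion which is surjective, since all rational points are in its image. -/
theorem mono_of_formallyUnramified [QuasiCompact X.hom] {Y : Over (Spec (.of k))}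
    [LocallyOfFiniteType Y.hom] (f : X ⟶ Y) [FormallyUnramified f.left]
    (hf : Function.Injective fun x : Points X ↦ x ≫ f) : Mono f.left := by
  have := locallyOfFiniteType_left f
  rw [← Limits.pullback.isIso_diagonal_iff]
  have hs : Surjective (Limits.pullback.diagonal f.left) := by
    let Z : Over (Spec (.of k)) := Over.mk (Limits.pullback.fst f.left f.left ≫ X.hom)
    have : LocallyOfFiniteType Z.hom :=
      inferInstanceAs (LocallyOfFiniteType (Limits.pullback.fst f.left f.left ≫ X.hom))
    let p₁ : Z ⟶ X := Over.homMk (Limits.pullback.fst f.left f.left) rfl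
    let p₂ : Z ⟶ X := Over.homMk (Limits.pullback.snd f.left f.left) (by
      change Limits.pullback.snd f.left f.left ≫ X.hom = Limits.pullback.fst f.left f.left ≫ X.hom
      rw [← Over.w f, ← Category.assoc, ← Category.assoc, Limits.pullback.condition])
    let δ : X ⟶ Z := Over.homMk (Limits.pullback.diagonal f.left) (by simp [Z])
    have hp : p₁ ≫ f = p₂ ≫ f := Over.OverMorphism.ext Limits.pullback.condition
    refine ⟨fun z ↦ ?_⟩
    by_contra hz
    obtain ⟨z', hz'⟩ := Points.exists_toScheme_mem (X := Z)
      (Z := (Set.range (Limits.pullback.diagonal f.left))ᶜ) ⟨z, hz⟩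
      (Limits.pullback.diagonal f.left).isOpenEmbedding.isOpen_range.isClosed_compl.isLocallyClosed
    have h1 : z' ≫ p₁ = z' ≫ p₂ := hf (by simp only [Category.assoc, hp])
    have h2 : z' = (z' ≫ p₁) ≫ δ := by
      apply Over.OverMorphism.ext
      apply Limits.pullback.hom_ext
      · simp [δ, p₁]
      · rw [h1]
        simp [δ, p₂]
    exact hz' ⟨Points.toScheme (z' ≫ p₁), (congrArg Points.toScheme h2).symm⟩
  have : Epi (Limits.pullback.diagonal f.left).base := (TopCat.epi_iff_surjective _).mpr hs.surj
  exact IsOpenImmersion.isIso _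

/-- The image of a flat morphism is open, so it suffices that it contains all rational points. -/
theorem surjective_of_flat {Y : Over (Spec (.of k))} [QuasiCompact X.hom]
    [LocallyOfFiniteType Y.hom] (f : X ⟶ Y) [Flat f.left]
    (hf : Function.Surjective fun x : Points X ↦ x ≫ f) : Surjective f.left := by
  have := locallyOfFiniteType_left f
  have := isLocallyNoetherian_left (X := X)
  have := isLocallyNoetherian_left (X := Y)
  have : LocallyOfFinitePresentation f.left :=
    LocallyOfFinitePresentation.iff_locallyOfFiniteType.mpr inferInstance
  refine ⟨fun y ↦ ?_⟩
  by_contra hy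
  obtain ⟨y', hy'⟩ := Points.exists_toScheme_mem (X := Y) (Z := (Set.range f.left)ᶜ) ⟨y, hy⟩
    f.left.isOpenMap.isOpen_range.isClosed_compl.isLocallyClosed
  obtain ⟨x, rfl⟩ := hf y'
  exact hy' ⟨x.toScheme, rfl⟩

/-- If `A` is an algebraic family of automorphisms of `X`, then `(a, x) ↦ (a, ρ a x)` is an
automorphism of `A × X`: it is flat and unramified, and bijective on rational points, hence a
surjective flat monomorphism. -/
theorem isIso_lift_of_isMorphism [QuasiCompact A.hom] [QuasiCompact X.hom] [IsReduced X.left]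
    [IsSeparated X.hom] [IsSeparated A.hom] {ρ : Points A → Aut X} {φ : A ⊗ X ⟶ X}
    (hφ : ∀ (a : Points A) (x : Points X), lift a x ≫ φ = ρ a • x) :
    IsIso (lift (fst A X) φ) := by
  have hlift (a : Points A) (x : Points X) : lift a x ≫ lift (fst A X) φ = lift a (ρ a • x) := by
    rw [comp_lift, lift_fst, hφ]
  have h (a : Points A) : lift (toUnit X ≫ a) (𝟙 X) ≫ φ = (ρ a).hom := by
    apply Points.hom_ext
    intro x
    rw [← Category.assoc, ← lift_eq_comp_right, hφ]
    rfl
  obtain ⟨_, _⟩ := flat_and_formallyUnramified_of_slices (lift (fst A X) φ) (lift_fst _ _)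
    fun a ↦ by rw [lift_snd, h]; exact Iso.isIso_hom (C := Over (Spec (.of k))) (ρ a)
  have : Mono (lift (fst A X) φ).left := by
    refine mono_of_formallyUnramified _ fun p q hpq ↦ ?_
    rw [← lift_comp_fst_snd p, ← lift_comp_fst_snd q] at hpq ⊢
    simp only [hlift] at hpq
    have h1 : p ≫ fst A X = q ≫ fst A X := by
      simpa using congrArg (· ≫ fst A X) hpq
    have h2 : ρ (p ≫ fst A X) • (p ≫ snd A X) = ρ (q ≫ fst A X) • (q ≫ snd A X) := by
      simpa using congrArg (· ≫ snd A X) hpq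
    rw [h1, smul_left_cancel_iff] at h2
    rw [h1, h2]
  have : Surjective (lift (fst A X) φ).left := by
    refine surjective_of_flat _ fun p ↦ ?_
    refine ⟨lift (p ≫ fst A X) ((ρ (p ≫ fst A X))⁻¹ • (p ≫ snd A X)), ?_⟩
    simp only [hlift, smul_inv_smul]
    exact lift_comp_fst_snd p
  have : QuasiCompact (lift (fst A X) φ).left := by
    have : QuasiCompact ((lift (fst A X) φ).left ≫ (A ⊗ X).hom) := by
      rw [Over.w]; infer_instance
    exact QuasiCompact.of_comp _ (A ⊗ X).hom
  have : IsIso (lift (fst A X) φ).left := Flat.isIso_of_surjective_of_mono _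
  have : IsIso ((Over.forget _).map (lift (fst A X) φ)) := this
  exact isIso_of_reflects_iso (lift (fst A X) φ) (Over.forget _)

theorem IsMorphism.inv [QuasiCompact A.hom] [QuasiCompact X.hom] [IsReduced X.left]
    [IsSeparated X.hom] [IsSeparated A.hom] {ρ : Points A → Aut X} (h : IsMorphism ρ) :
    IsMorphism fun a ↦ (ρ a)⁻¹ := by
  obtain ⟨φ, hφ⟩ := h
  have := isIso_lift_of_isMorphism hφ
  refine ⟨CategoryTheory.inv (lift (fst A X) φ) ≫ snd A X, fun a x ↦ ?_⟩
  have h1 : lift a ((ρ a)⁻¹ • x) ≫ lift (fst A X) φ = lift a x := by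
    rw [comp_lift, lift_fst, hφ, smul_inv_smul]
  rw [← h1, Category.assoc, IsIso.hom_inv_id_assoc, lift_snd]

end Inverse

theorem IsIrreducibleConstructible.inv {k : Type u} [Field k] [IsAlgClosed k]
    {X : Over (Spec (.of k))} (hX : IsVariety X) {V : Set (Aut X)}
    (hV : IsIrreducibleConstructible V) : IsIrreducibleConstructible V⁻¹ := by
  obtain ⟨A, ⟨hA', hA⟩, ρ, hρ, rfl⟩ := hV
  have := hA'.quasiCompact
  have := hA'.isSeparated
  have := hA'.locallyOfFiniteType
  have := hX.quasiCompact
  have := hX.isSeparated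
  have := hX.isReduced
  have := hX.locallyOfFiniteType
  refine ⟨A, ⟨hA', hA⟩, _, hρ.inv, ?_⟩
  rw [← Set.image_inv_eq_inv, ← Set.range_comp]
  rfl

end AutVariety

/-! ### Krull dimension and transcendence degree -/

namespace AutVariety

open TopologicalSpace Topology IsLocalRing Order

section Algebra

/-- Going up yields `≤`, and incomparability yields `≥`. -/
theorem ringKrullDim_eq_of_isIntegral {R S : Type*} [CommRing R] [CommRing S] [IsDomain S]
    [Algebra R S] [Algebra.IsIntegral R S] (hinj : Function.Injective (algebraMap R S)) :
    ringKrullDim R = ringKrullDim S := by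
  apply le_antisymm
  · refine iSup_le fun l ↦ ?_
    obtain ⟨Q, -, hQ, h⟩ := Ideal.exists_ideal_over_prime_of_isIntegral_of_isPrime
      (S := S) (RelSeries.head l).asIdeal ⊥
        (by rw [← RingHom.ker_eq_comap_bot, (RingHom.injective_iff_ker_eq_bot _).mp hinj]
            exact bot_le)
    have : Q.LiesOver (RelSeries.head l).asIdeal := ⟨h.symm⟩
    obtain ⟨L, hL, -⟩ := Ideal.exists_ltSeries_of_hasGoingUp l Q
    rw [← hL]
    exact LTSeries.length_le_krullDim L
  · exact krullDim_le_of_strictMono (PrimeSpectrum.comap (algebraMap R S)) fun I J h ↦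
      Ideal.IsIntegral.comap_lt_comap (I := I.asIdeal) (J := J.asIdeal) h

variable {k R K : Type u} [Field k] [CommRing R] [Algebra k R] [Algebra.FiniteType k R]

/-- By Noether normalization this reduces to polynomial rings. -/
theorem ringKrullDim_eq_trdeg [IsDomain R] :
    ringKrullDim R = (Cardinal.toNat (Algebra.trdeg k R) : WithBot ℕ∞) := by
  obtain ⟨s, g, hinj, hint⟩ := exists_integral_inj_algHom_of_fg k R
  algebraize [g.toRingHom]
  have hinj' : Function.Injective (algebraMap (MvPolynomial (Fin s) k) R) := hinj
  have : FaithfulSMul (MvPolynomial (Fin s) k) R :=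
    (faithfulSMul_iff_algebraMap_injective _ _).mpr hinj'
  have : IsScalarTower k (MvPolynomial (Fin s) k) R := .of_algHom g
  rw [← ringKrullDim_eq_of_isIntegral hinj', MvPolynomial.ringKrullDim_of_isNoetherianRing,
    ringKrullDim_eq_zero_of_field, ← trdeg_add_eq k (MvPolynomial (Fin s) k) (A := R),
    MvPolynomial.trdeg_of_isDomain, trdeg_eq_zero]
  simp

theorem ringKrullDim_lt_top_of_finiteType (k R : Type u) [Field k] [CommRing R] [Algebra k R]
    [Algebra.FiniteType k R] : ringKrullDim R < ⊤ := by
  obtain ⟨n, f, hf⟩ := Algebra.FiniteType.iff_quotient_mvPolynomial''.mp ‹Algebra.FiniteType k R›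
  refine (ringKrullDim_le_of_surjective f.toRingHom hf).trans_lt ?_
  rw [MvPolynomial.ringKrullDim_of_isNoetherianRing, ringKrullDim_eq_zero_of_field, zero_add]
  exact WithBot.coe_lt_coe.mpr (ENat.natCast_lt_top _)

/-- The Krull dimension of the image of `g` is the transcendence degree of the field `K`, which by
the hypothesis `hg` is the field of fractions of the image. -/
theorem ringKrullDim_quotient_ker_eq_trdeg [Field K] [Algebra k K] (g : R →ₐ[k] K)
    (hg : ∀ z, ∃ r s, g s ≠ 0 ∧ g s * z = g r) :
    ringKrullDim (R ⧸ RingHom.ker g) = (Cardinal.toNat (Algebra.trdeg k K) : WithBot ℕ∞) := by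
  let P := RingHom.ker g
  have : P.IsPrime := RingHom.ker_isPrime g
  let g' : R ⧸ P →ₐ[k] K := Ideal.kerLiftAlg g
  have hg' : Function.Injective g' := Ideal.kerLiftAlg_injective g
  algebraize [g'.toRingHom]
  have : FaithfulSMul (R ⧸ P) K := (faithfulSMul_iff_algebraMap_injective _ _).mpr hg'
  have : IsScalarTower k (R ⧸ P) K := .of_algHom g'
  have : Algebra.IsAlgebraic (R ⧸ P) K := by
    refine ⟨fun z ↦ ?_⟩
    obtain ⟨r, s, hs, hz⟩ := hg z
    have := isAlgebraic_algebraMap (R := R ⧸ P) (A := K) (Ideal.Quotient.mk P r)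
    have := isAlgebraic_algebraMap (R := R ⧸ P) (A := K) (Ideal.Quotient.mk P s)
    have h1 : z = g r * (g s)⁻¹ := by
      rw [eq_mul_inv_iff_mul_eq₀ hs, mul_comm]
      exact hz
    rw [h1]
    exact IsAlgebraic.mul ‹_› (IsAlgebraic.inv ‹_›)
  rw [ringKrullDim_eq_trdeg (k := k), ← trdeg_add_eq k (R ⧸ P) (A := K),
    trdeg_eq_zero (R := R ⧸ P), add_zero]

theorem ringKrullDim_quotient_lt {P Q : Ideal R} [P.IsPrime] (h : P < Q) :
    ringKrullDim (R ⧸ Q) + 1 ≤ ringKrullDim (R ⧸ P) := by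
  obtain ⟨hle, x, hxQ, hxP⟩ := SetLike.lt_iff_le_and_exists.mp h
  refine ringKrullDim_succ_le_of_surjective (Ideal.Quotient.factor hle)
    (Ideal.Quotient.factor_surjective hle)
    (r := Ideal.Quotient.mk P x) ?_ ?_
  · rw [mem_nonZeroDivisors_iff_ne_zero]
    rwa [Ne, Ideal.Quotient.eq_zero_iff_mem]
  · rw [Ideal.Quotient.factor_mk, Ideal.Quotient.eq_zero_iff_mem]
    exact hxQ

end Algebra

end AutVariety

/-! ### The dimension of locally closed sets of rational points -/

namespace AutVariety

open TopologicalSpace Topology IsLocalRing Order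

noncomputable section Dimension

variable {k : Type u} [Field k] {X Y : Over (Spec (.of k))}

/-- The transcendence degree over `k` of the residue field of a point `p` of a `k`-scheme. If the
scheme is locally of finite type, then this is the dimension of the closure of `p`. -/
def residueTrdeg (X : Over (Spec (.of k))) (p : X.left) : ℕ :=
  letI : Algebra k (X.left.residueField p) :=
    (Spec.preimage (X.left.fromSpecResidueField p ≫ X.hom)).hom.toAlgebra
  Cardinal.toNat (Algebra.trdeg k (X.left.residueField p))

theorem fromSpecResidueField_eq_evaluation {X : Scheme.{u}} {V : X.Opens} (hV : IsAffineOpen V)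
    {p : X} (hp : p ∈ V) :
    X.fromSpecResidueField p = Spec.map (X.evaluation V p hp) ≫ hV.fromSpec := by
  rw [Scheme.fromSpecResidueField, ← hV.fromSpecStalk_eq_fromSpecStalk hp,
    IsAffineOpen.fromSpecStalk, ← Scheme.germ_residue, Spec.map_comp, Category.assoc]

theorem ker_evaluation {X : Scheme.{u}} {V : X.Opens} (hV : IsAffineOpen V) {p : X} (hp : p ∈ V) :
    RingHom.ker (X.evaluation V p hp).hom = (hV.primeIdealOf ⟨p, hp⟩).asIdeal := by
  rw [hV.primeIdealOf_eq_map_closedPoint, ← Scheme.germ_residue, CommRingCat.hom_comp]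
  refine (RingHom.comap_ker _ _).symm.trans ?_
  exact congrArg (Ideal.comap _) (ker_residue (R := X.presheaf.stalk p))

theorem exists_evaluation_mul_eq {X : Scheme.{u}} {V : X.Opens} (hV : IsAffineOpen V) {p : X}
    (hp : p ∈ V) (z : X.residueField p) : ∃ r s, X.evaluation V p hp s ≠ 0 ∧
      X.evaluation V p hp s * z = X.evaluation V p hp r := by
  obtain ⟨t, rfl⟩ := X.residue_surjective p z
  let : Algebra Γ(X, V) (X.presheaf.stalk p) := (X.presheaf.germ V p hp).hom.toAlgebra
  have : IsLocalization.AtPrime (X.presheaf.stalk p) (hV.primeIdealOf ⟨p, hp⟩).asIdeal :=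
    hV.isLocalization_stalk ⟨p, hp⟩
  obtain ⟨⟨r, s⟩, h⟩ := IsLocalization.surj (hV.primeIdealOf ⟨p, hp⟩).asIdeal.primeCompl
    (S := X.presheaf.stalk p) t
  refine ⟨r, s, fun h0 ↦ s.2 ?_, ?_⟩
  · exact (ker_evaluation hV hp).le h0
  · have h1 : t * X.presheaf.germ V p hp s = X.presheaf.germ V p hp r := h
    rw [← Scheme.germ_residue, mul_comm]
    refine Eq.trans ?_ (congrArg (X.residue p) h1)
    exact (map_mul (X.residue p).hom t (X.presheaf.germ V p hp s)).symm

theorem finiteType_preimage_fromSpec [LocallyOfFiniteType X.hom] {V : X.left.Opens}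
    (hV : IsAffineOpen V) :
    (Spec.preimage (hV.fromSpec ≫ X.hom)).hom.FiniteType := by
  rw [← HasRingHomProperty.Spec_iff (P := @LocallyOfFiniteType), Spec.map_preimage]
  infer_instance

/-- In an affine chart, the residue field at `p` is the field of fractions of the quotient by the
prime ideal of `p`. -/
theorem ringKrullDim_eq_residueTrdeg [LocallyOfFiniteType X.hom] {V : X.left.Opens}
    (hV : IsAffineOpen V) {p : X.left} (hp : p ∈ V) :
    ringKrullDim (Γ(X.left, V) ⧸ (hV.primeIdealOf ⟨p, hp⟩).asIdeal) =
      (residueTrdeg X p : WithBot ℕ∞) := by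
  let : Algebra k (X.left.residueField p) :=
    (Spec.preimage (X.left.fromSpecResidueField p ≫ X.hom)).hom.toAlgebra
  let : Algebra k Γ(X.left, V) := (Spec.preimage (hV.fromSpec ≫ X.hom)).hom.toAlgebra
  have : Algebra.FiniteType k Γ(X.left, V) := finiteType_preimage_fromSpec hV
  have h : Spec.preimage (hV.fromSpec ≫ X.hom) ≫ X.left.evaluation V p hp =
      Spec.preimage (X.left.fromSpecResidueField p ≫ X.hom) := by
    apply Spec.map_injective
    rw [Spec.map_comp, Spec.map_preimage, Spec.map_preimage,
      fromSpecResidueField_eq_evaluation hV hp, Category.assoc]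
  let g : Γ(X.left, V) →ₐ[k] X.left.residueField p :=
    { (X.left.evaluation V p hp).hom with
      commutes' := fun r ↦ congr($(h).hom r) }
  rw [← ker_evaluation hV hp]
  exact ringKrullDim_quotient_ker_eq_trdeg g (exists_evaluation_mul_eq hV hp)

theorem primeIdealOf_lt {X : Scheme.{u}} {V : X.Opens} (hV : IsAffineOpen V) {p q : X}
    (hp : p ∈ V) (hq : q ∈ V) (h : p ⤳ q) (hne : p ≠ q) :
    (hV.primeIdealOf ⟨p, hp⟩).asIdeal < (hV.primeIdealOf ⟨q, hq⟩).asIdeal := by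
  have : hV.primeIdealOf ⟨p, hp⟩ ≤ hV.primeIdealOf ⟨q, hq⟩ := by
    rw [PrimeSpectrum.le_iff_specializes]
    apply hV.fromSpec.isOpenEmbedding.isInducing.specializes_iff.mp
    rwa [hV.fromSpec_primeIdealOf, hV.fromSpec_primeIdealOf]
  refine lt_of_le_of_ne this fun he ↦ hne ?_
  exact (hV.fromSpec_primeIdealOf ⟨p, hp⟩).symm.trans
    ((congrArg hV.fromSpec (PrimeSpectrum.ext he)).trans (hV.fromSpec_primeIdealOf ⟨q, hq⟩))

theorem residueTrdeg_lt [LocallyOfFiniteType X.hom] {p q : X.left} (h : p ⤳ q) (hne : p ≠ q) :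
    residueTrdeg X q < residueTrdeg X p := by
  obtain ⟨V, hV, hq, -⟩ := exists_isAffineOpen_mem_and_subset (x := q) (U := ⊤) trivial
  have hp : p ∈ V := h.mem_open V.2 hq
  have := ringKrullDim_quotient_lt (primeIdealOf_lt hV hp hq h hne)
  rw [ringKrullDim_eq_residueTrdeg, ringKrullDim_eq_residueTrdeg] at this
  exact_mod_cast this

theorem residueTrdeg_le [LocallyOfFiniteType X.hom] {p q : X.left} (h : p ⤳ q) :
    residueTrdeg X q ≤ residueTrdeg X p := by
  rcases eq_or_ne p q with rfl | hne
  · rfl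
  · exact (residueTrdeg_lt h hne).le

variable (X) in
theorem exists_residueTrdeg_le [LocallyOfFiniteType X.hom] [QuasiCompact X.hom] :
    ∃ n, ∀ p : X.left, residueTrdeg X p ≤ n := by
  have := compactSpace_left (X := X)
  have key := (isCompact_univ (X := X.left)).induction_on
    (p := fun s ↦ ∃ n, ∀ p ∈ s, residueTrdeg X p ≤ n)
    ⟨0, by simp⟩ (fun s t hst ⟨n, hn⟩ ↦ ⟨n, fun p hp ↦ hn p (hst hp)⟩)
    (fun s t ⟨n, hn⟩ ⟨m, hm⟩ ↦ ⟨max n m, fun p hp ↦ hp.elim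
      (fun h ↦ (hn p h).trans (le_max_left _ _)) (fun h ↦ (hm p h).trans (le_max_right _ _))⟩)
    (fun q _ ↦ ?_)
  · obtain ⟨n, hn⟩ := key
    exact ⟨n, fun p ↦ hn p trivial⟩
  obtain ⟨V, hV, hq, -⟩ := exists_isAffineOpen_mem_and_subset (x := q) (U := ⊤) trivial
  let : Algebra k Γ(X.left, V) := (Spec.preimage (hV.fromSpec ≫ X.hom)).hom.toAlgebra
  have : Algebra.FiniteType k Γ(X.left, V) := finiteType_preimage_fromSpec hV
  refine ⟨V, mem_nhdsWithin_of_mem_nhds (V.2.mem_nhds hq), ?_⟩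
  obtain ⟨n, hn⟩ : ∃ n : ℕ, ringKrullDim Γ(X.left, V) ≤ n := by
    have hlt := ringKrullDim_lt_top_of_finiteType k Γ(X.left, V)
    generalize ringKrullDim Γ(X.left, V) = d at hlt
    induction d with
    | bot => exact ⟨0, bot_le⟩
    | coe d =>
      obtain ⟨n, rfl⟩ := ENat.ne_top_iff_exists.mp (WithBot.coe_lt_coe.mp hlt).ne
      exact ⟨n, le_rfl⟩
  refine ⟨n, fun p hp ↦ ?_⟩
  have := (ringKrullDim_quotient_le (hV.primeIdealOf ⟨p, hp⟩).asIdeal).trans hn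
  rw [ringKrullDim_eq_residueTrdeg hV hp] at this
  exact_mod_cast this

/-- The residue field extension at a point where a morphism is quasi-finite is finite. -/
theorem residueTrdeg_eq_of_quasiFiniteAt (f : Y ⟶ X) {y : Y.left} (h : f.left.QuasiFiniteAt y) :
    residueTrdeg X (f.left y) = residueTrdeg Y y := by
  let : Algebra k (X.left.residueField (f.left y)) :=
    (Spec.preimage (X.left.fromSpecResidueField (f.left y) ≫ X.hom)).hom.toAlgebra
  let : Algebra k (Y.left.residueField y) :=
    (Spec.preimage (Y.left.fromSpecResidueField y ≫ Y.hom)).hom.toAlgebra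
  let : Algebra (X.left.residueField (f.left y)) (Y.left.residueField y) :=
    (f.left.residueFieldMap y).hom.toAlgebra
  have hc : Spec.preimage (X.left.fromSpecResidueField (f.left y) ≫ X.hom) ≫
      f.left.residueFieldMap y = Spec.preimage (Y.left.fromSpecResidueField y ≫ Y.hom) := by
    apply Spec.map_injective
    rw [Spec.map_comp, Spec.map_preimage, Spec.map_preimage,
      Scheme.Hom.SpecMap_residueFieldMap_fromSpecResidueField_assoc, Over.w f]
  have : IsScalarTower k (X.left.residueField (f.left y)) (Y.left.residueField y) :=
    .of_algebraMap_eq' congr($(hc).hom).symm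
  have hfin : ((f.left.stalkMap y ≫ Y.left.residue y)).hom.QuasiFinite := by
    rw [CommRingCat.hom_comp]
    exact (RingHom.QuasiFinite.of_finite
      (RingHom.Finite.of_surjective _ (Y.left.residue_surjective y))).comp h
  rw [← Scheme.residue_residueFieldMap, CommRingCat.hom_comp] at hfin
  have h2 : Algebra.QuasiFinite (X.left.residueField (f.left y)) (Y.left.residueField y) :=
    hfin.of_comp
  have h3 : Module.Finite (X.left.residueField (f.left y)) (Y.left.residueField y) :=
    .of_quasiFinite
  rw [residueTrdeg, residueTrdeg, ← trdeg_add_eq k (X.left.residueField (f.left y))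
    (A := Y.left.residueField y), trdeg_eq_zero (R := X.left.residueField (f.left y)), add_zero]

theorem krullDim_le_of_strictMono_nat {α : Type*} [Preorder α] (f : α → ℕ) (hf : StrictMono f)
    {n : ℕ} (hn : ∀ a, f a ≤ n) : krullDim α ≤ n := by
  refine iSup_le fun l ↦ ?_
  have := (Nat.le_add_left _ _).trans ((l.map f hf).head_add_length_le_nat)
  exact_mod_cast this.trans (hn _)

/-- The generic point of the closure of the image of an irreducible closed set. -/
def genericPointOfClosed {T : Type*} [TopologicalSpace T] {f : T → X.left} (hf : Continuous f)
    (Z : IrreducibleCloseds T) : X.left :=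
  (Z.isIrreducible.image f hf.continuousOn).genericPoint

theorem closure_genericPointOfClosed {T : Type*} [TopologicalSpace T] {f : T → X.left}
    (hf : Continuous f) (Z : IrreducibleCloseds T) :
    closure {genericPointOfClosed hf Z} = closure (f '' Z) :=
  IsIrreducible.genericPoint_closure_eq _

/-- This bounds the lengths of chains of irreducible closed subsets of `T`. -/
theorem strictMono_residueTrdeg [LocallyOfFiniteType X.hom] {T : Type*} [TopologicalSpace T]
    {f : T → X.left} (hf : IsInducing f) :
    StrictMono fun Z ↦ residueTrdeg X (genericPointOfClosed hf.continuous Z) := by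
  intro Z W h
  have hle : closure (f '' Z) ⊆ closure (f '' W) := closure_mono (Set.image_mono h.le)
  rw [← closure_genericPointOfClosed hf.continuous,
    ← closure_genericPointOfClosed hf.continuous] at hle
  refine residueTrdeg_lt (specializes_iff_closure_subset.mpr hle) fun he ↦ h.ne ?_
  apply SetLike.coe_injective
  rw [← Z.isClosed.closure_eq, ← W.isClosed.closure_eq, hf.closure_eq_preimage_closure_image,
    hf.closure_eq_preimage_closure_image, ← closure_genericPointOfClosed hf.continuous,
    ← closure_genericPointOfClosed hf.continuous, he]

theorem wellFoundedGT_irreducibleCloseds [LocallyOfFiniteType X.hom] [QuasiCompact X.hom]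
    {T : Type*} [TopologicalSpace T] {f : T → X.left} (hf : IsInducing f) :
    WellFoundedGT (IrreducibleCloseds T) := by
  obtain ⟨n, hn⟩ := exists_residueTrdeg_le X
  let g : IrreducibleCloseds T → Fin (n + 1) := fun Z ↦
    ⟨residueTrdeg X (genericPointOfClosed hf.continuous Z), Nat.lt_succ_of_le (hn _)⟩
  have hg : StrictMono g := strictMono_residueTrdeg hf
  exact hg.wellFoundedGT

theorem topologicalKrullDim_le_residueTrdeg [LocallyOfFiniteType X.hom] {T : Type*}
    [TopologicalSpace T] {f : T → X.left} (hf : IsInducing f) {p : X.left} (hp : ∀ x, p ⤳ f x) :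
    topologicalKrullDim T ≤ residueTrdeg X p := by
  refine krullDim_le_of_strictMono_nat _ (strictMono_residueTrdeg hf) fun Z ↦ residueTrdeg_le ?_
  rw [specializes_iff_closure_subset, closure_genericPointOfClosed hf.continuous]
  refine closure_minimal ?_ isClosed_closure
  rintro _ ⟨x, -, rfl⟩
  exact (hp x).mem_closure

/-- The dimension of an irreducible locally closed set `O` of rational points is the
transcendence degree of the residue field at the generic point `p` of its closure. For the lower
bound, the primes of the coordinate ring of an affine open subset of the closure of `p` contained
in `O` are turned into irreducible closed subsets of `O`. -/
theorem Points.topologicalKrullDim_eq_residueTrdeg [IsAlgClosed k] [LocallyOfFiniteType X.hom]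
    {O : Set (Points X)} (hO : IsLocallyClosed O) {p : X.left}
    (hp : closure {p} = closure (toScheme '' O)) : topologicalKrullDim O = residueTrdeg X p := by
  have hind : IsInducing fun x : O ↦ x.1.toScheme :=
    (isInducing_toScheme (X := X)).comp IsInducing.subtypeVal
  refine le_antisymm (topologicalKrullDim_le_residueTrdeg hind fun x ↦ ?_) ?_
  · rw [specializes_iff_mem_closure, hp]
    exact subset_closure ⟨_, x.2, rfl⟩
  obtain ⟨_, _, hU', hC', rfl⟩ := hO
  obtain ⟨U, hU, rfl⟩ := isInducing_toScheme.isOpen_iff.mp hU'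
  obtain ⟨C, hC, rfl⟩ := isInducing_toScheme.isClosed_iff.mp hC'
  rw [← Set.preimage_inter] at hp ⊢
  -- a non-empty locally closed set contains the generic points of its closure
  have hpUC : p ∈ U ∩ C := by
    rw [closure_toScheme_image_preimage (hU.isLocallyClosed.inter hC.isLocallyClosed)] at hp
    have hpcl : p ∈ closure (U ∩ C) := by rw [← hp]; exact subset_closure rfl
    have hpC : p ∈ C := closure_minimal Set.inter_subset_right hC hpcl
    refine ⟨?_, hpC⟩
    by_contra hpU
    have h1 : closure {p} ⊆ Uᶜ :=
      closure_minimal (Set.singleton_subset_iff.mpr hpU) hU.isClosed_compl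
    have h2 : U ∩ C = ∅ := by
      rw [Set.eq_empty_iff_forall_notMem]
      exact fun q hq ↦ h1 (hp ▸ subset_closure hq) hq.1
    rw [h2, closure_empty] at hpcl
    exact hpcl
  obtain ⟨V, hV, hpV, hVU⟩ := exists_isAffineOpen_mem_and_subset (x := p) (U := ⟨U, hU⟩) hpUC.1
  rw [← ringKrullDim_eq_residueTrdeg hV hpV]
  let P := (hV.primeIdealOf ⟨p, hpV⟩).asIdeal
  -- the point of `V` given by a prime ideal containing `P`
  let e (Q : PrimeSpectrum (Γ(X.left, V) ⧸ P)) : X.left :=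
    hV.fromSpec (PrimeSpectrum.comap (Ideal.Quotient.mk P) Q)
  have heinj : Function.Injective e := hV.fromSpec.isOpenEmbedding.injective.comp
    (PrimeSpectrum.comap_injective_of_surjective _ Ideal.Quotient.mk_surjective)
  have hele {Q Q'} (h : Q ≤ Q') : e Q ⤳ e Q' := by
    have : PrimeSpectrum.comap (Ideal.Quotient.mk P) Q ⤳
        PrimeSpectrum.comap (Ideal.Quotient.mk P) Q' := by
      rw [← PrimeSpectrum.le_iff_specializes]
      exact Ideal.comap_mono (f := Ideal.Quotient.mk P) h
    exact this.map hV.fromSpec.continuous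
  have hep (Q) : p ⤳ e Q := by
    have h : hV.primeIdealOf ⟨p, hpV⟩ ⤳ PrimeSpectrum.comap (Ideal.Quotient.mk P) Q := by
      rw [← PrimeSpectrum.le_iff_specializes]
      intro r hr
      have h0 : Ideal.Quotient.mk P r = 0 := Ideal.Quotient.eq_zero_iff_mem.mpr hr
      exact Ideal.mem_comap.mpr (h0 ▸ Q.asIdeal.zero_mem)
    have := h.map hV.fromSpec.continuous
    rwa [hV.fromSpec_primeIdealOf] at this
  have heU (Q) : e Q ∈ U := hVU (hV.range_fromSpec.le (Set.mem_range_self _))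
  have he (Q) : IsLocallyClosed (U ∩ C ∩ closure {e Q}) :=
    (hU.isLocallyClosed.inter hC.isLocallyClosed).inter isClosed_closure.isLocallyClosed
  have hcl (Q) : closure (U ∩ C ∩ closure {e Q}) = closure {e Q} := by
    refine subset_antisymm (closure_minimal Set.inter_subset_right isClosed_closure)
      (closure_mono ?_)
    exact Set.singleton_subset_iff.mpr ⟨⟨heU Q, (hep Q).mem_closed hC hpUC.2⟩, subset_closure rfl⟩
  have hval (Q) : Subtype.val '' ((fun x : (toScheme ⁻¹' (U ∩ C) : Set (Points X)) ↦
      x.1.toScheme) ⁻¹' closure {e Q}) = toScheme ⁻¹' (U ∩ C ∩ closure {e Q}) := by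
    exact Subtype.image_preimage_coe _ (toScheme ⁻¹' closure {e Q})
  let F (Q : PrimeSpectrum (Γ(X.left, V) ⧸ P)) :
      IrreducibleCloseds (toScheme ⁻¹' (U ∩ C) : Set (Points X)) :=
    { carrier := (fun x ↦ x.1.toScheme) ⁻¹' closure {e Q}
      isClosed' := isClosed_closure.preimage hind.continuous
      isIrreducible' := by
        rw [← isIrreducible_image_iff_of_isInducing IsInducing.subtypeVal]
        rw [hval, isIrreducible_preimage_iff (he Q), ← isIrreducible_iff_closure, hcl]
        exact isIrreducible_singleton.closure }
  have hF (Q) : closure (toScheme '' (Subtype.val '' (F Q).carrier)) = closure {e Q} := by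
    rw [hval, closure_toScheme_image_preimage (he Q), hcl]
  have hF' : StrictMono fun Q ↦ OrderDual.toDual (F Q) := by
    intro Q Q' h
    refine lt_of_le_of_ne (fun x hx ↦ ?_) fun heq ↦ h.ne (heinj ?_)
    · exact (hele h.le).closure_subset hx
    · have : closure {e Q} = closure {e Q'} := by rw [← hF, ← hF, OrderDual.toDual.injective heq]
      exact ((specializes_iff_closure_subset.mpr this.ge).antisymm
        (specializes_iff_closure_subset.mpr this.le)).eq
  exact (krullDim_le_of_strictMono _ hF').trans krullDim_orderDual.le

end Dimension

end AutVariety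

/-! ### Uniformity of orbits and connected algebraic groups -/

namespace AutVariety

open TopologicalSpace Topology IsLocalRing Order

section Uniformity

variable {k : Type u} [Field k] [IsAlgClosed k] {X : Over (Spec (.of k))}

/-- The uniformity of orbits for coverings by irreducible constructible subsets. -/
theorem IsOrbitCover.exists_orbit_eq_of_isIrreducibleConstructible [LocallyOfFiniteType X.hom]
    [QuasiCompact X.hom] {G : Subgroup (Aut X)} {𝓕 : Set (Set (Aut X))} (h : IsOrbitCover G 𝓕)
    (h𝓕 : ∀ F ∈ 𝓕, IsIrreducibleConstructible F) :
    ∃ F ∈ 𝓕, ∀ x : Points X, MulAction.orbit G x = (· • x) '' F := by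
  have := wellFoundedGT_irreducibleCloseds (X := X ⊗ X) Points.isInducing_toScheme
  have key : ∀ F ∈ 𝓕, ∀ Z : Set (Points X), IsClosed Z → IsIrreducible Z →
      IsIrreducible (Set.image2 (fun (g : Aut X) z ↦ lift (g • z) z) F Z) ∧
      ContainsOpenOfClosure (Set.image2 (fun (g : Aut X) z ↦ lift (g • z) z) F Z) := by
    intro F hF Z hZ hZ'
    obtain ⟨A, ⟨⟨_, _, _, _⟩, hA⟩, ρ, ⟨φ, hφ⟩, rfl⟩ := h𝓕 F hF
    rw [← Points.irreducibleSpace_iff] at hA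
    have heq : Set.image2 (fun (g : Aut X) z ↦ lift (g • z) z) (Set.range ρ) Z =
        (fun p : Points (A ⊗ X) ↦ p ≫ lift φ (snd A X)) ''
          ((fun p : Points (A ⊗ X) ↦ p ≫ snd A X) ⁻¹' Z) := by
      rw [← Points.image2_lift, Set.image_image2, ← Set.image_univ, Set.image2_image_left]
      simp only [comp_lift, hφ, lift_snd]
    have hi := Points.isIrreducible_preimage_snd (A := A) hZ'
    rw [heq]
    exact ⟨hi.image _ (Points.continuous_comp _).continuousOn,
      Points.containsOpenOfClosure_image _ (hZ.preimage (Points.continuous_comp _)) hi⟩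
  refine h.exists_orbit_eq (fun y x ↦ (lift y x : Points (X ⊗ X))) (fun {x x' y y'} he ↦ ?_)
    (fun g ↦ ?_) (fun x ↦ ?_) (fun F hF x ↦ ?_) (fun F hF Z hZ hZ' ↦ (key F hF Z hZ hZ').1)
    (fun F hF Z hZ hZ' ↦ (key F hF Z hZ hZ').2)
  · exact ⟨by simpa using congr($he ≫ fst X X), by simpa using congr($he ≫ snd X X)⟩
  · convert Points.continuous_comp (lift g.hom (𝟙 X)) using 2 with z
    rw [comp_lift, Category.comp_id]
    rfl
  · simp only [lift_eq_comp_left]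
    exact Points.continuous_comp _
  · obtain ⟨A, ⟨⟨_, _, _, _⟩, hA⟩, ρ, ⟨φ, hφ⟩, rfl⟩ := h𝓕 F hF
    rw [← Points.irreducibleSpace_iff] at hA
    rw [← Set.range_comp, ← Set.image_univ]
    refine (IrreducibleSpace.isIrreducible_univ _).image _ (Continuous.continuousOn ?_)
    convert Points.continuous_comp (lift (𝟙 A) (toUnit A ≫ x) ≫ φ) using 2 with a
    rw [← Category.assoc, ← lift_eq_comp_left, hφ]
    rfl

theorem IsConnectedSubgroup.isOrbitCover (hX : IsVariety X) {G : Subgroup (Aut X)}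
    (hG : IsConnectedSubgroup G) :
    IsOrbitCover G {V | IsIrreducibleConstructible V ∧ V ⊆ G ∧ 1 ∈ V} where
  subset V hV := hV.2.1
  one_mem V hV := hV.2.2
  exists_mem g hg := by
    obtain ⟨A, hA, ρ, hρ, hsub, hg, h1⟩ := hG g hg
    exact ⟨_, ⟨⟨A, hA, ρ, hρ, rfl⟩, hsub, h1⟩, hg⟩
  exists_mul_subset V hV W hW :=
    ⟨_, ⟨hV.1.mul hW.1, (Set.mul_subset_mul hV.2.1 hW.2.1).trans (by simp),
      ⟨1, hV.2.2, 1, hW.2.2, one_mul 1⟩⟩, subset_rfl⟩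
  exists_inv_subset V hV :=
    ⟨_, ⟨hV.1.inv hX, (Set.inv_subset_inv.mpr hV.2.1).trans (by simp), by simpa using hV.2.2⟩,
      subset_rfl⟩

theorem exists_parametrizesOrbits (hX : IsVariety X) {G : Subgroup (Aut X)}
    (hG : IsConnectedSubgroup G) : ∃ V, ParametrizesOrbits G V := by
  have := hX.locallyOfFiniteType
  have := hX.quasiCompact
  obtain ⟨V, hV, h⟩ := (hG.isOrbitCover hX).exists_orbit_eq_of_isIrreducibleConstructible
    fun V hV ↦ hV.1
  exact ⟨V, hV.1, hV.2.1, hV.2.2, h⟩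

/-- If `R` contains `1` and generates a group, then the powers of `R R⁻¹` exhaust it. -/
theorem isOrbitCover_range_pow {M : Type*} [Group M] {R : Set M} (h1 : 1 ∈ R) :
    IsOrbitCover (Subgroup.closure R) {V | ∃ m : ℕ, 1 ≤ m ∧ V = (R * R⁻¹) ^ m} := by
  have hone : 1 ∈ R * R⁻¹ := ⟨1, h1, 1, by simpa using h1, one_mul 1⟩
  have hinv : (R * R⁻¹)⁻¹ = R * R⁻¹ := by rw [mul_inv_rev, inv_inv]
  have hsub (m : ℕ) : (R * R⁻¹) ^ m ⊆ Subgroup.closure R := by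
    have h : R * R⁻¹ ⊆ Subgroup.closure R :=
      (Set.mul_subset_mul Subgroup.subset_closure
        (Set.inv_subset_inv.mpr Subgroup.subset_closure)).trans (by simp)
    induction m with
    | zero => simp
    | succ m ih =>
      rw [pow_succ]
      exact (Set.mul_subset_mul ih h).trans (by simp)
  refine ⟨?_, ?_, fun g hg ↦ ?_, ?_, ?_⟩
  · rintro _ ⟨m, -, rfl⟩
    exact hsub m
  · rintro _ ⟨m, -, rfl⟩
    exact Set.one_mem_pow hone
  · suffices ∃ m : ℕ, 1 ≤ m ∧ g ∈ (R * R⁻¹) ^ m by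
      obtain ⟨m, hm, h⟩ := this
      exact ⟨_, ⟨m, hm, rfl⟩, h⟩
    induction hg using Subgroup.closure_induction with
    | mem g hg => exact ⟨1, le_rfl, by rw [pow_one]; exact ⟨g, hg, 1, by simpa using h1, mul_one g⟩⟩
    | one => exact ⟨1, le_rfl, by rwa [pow_one]⟩
    | mul g g' _ _ hg hg' =>
      obtain ⟨m, hm, hg⟩ := hg
      obtain ⟨m', hm', hg'⟩ := hg'
      exact ⟨m + m', by omega, by rw [pow_add]; exact Set.mul_mem_mul hg hg'⟩
    | inv g _ hg =>
      obtain ⟨m, hm, hg⟩ := hg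
      exact ⟨m, hm, by rwa [← hinv, inv_pow, Set.inv_mem_inv]⟩
  · rintro _ ⟨m, hm, rfl⟩ _ ⟨m', hm', rfl⟩
    exact ⟨_, ⟨m + m', by omega, rfl⟩, (pow_add _ _ _).symm.subset⟩
  · rintro _ ⟨m, hm, rfl⟩
    exact ⟨_, ⟨m, hm, rfl⟩, by rw [← inv_pow, hinv]⟩

theorem exists_parametrizesOrbits_pow (hX : IsVariety X) {A : Over (Spec (.of k))}
    {ρ : Points A → Aut X} (hA : IsIrreducibleVariety A) (hρ : IsMorphism ρ)
    (h1 : 1 ∈ Set.range ρ) :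
    ∃ m : ℕ, 1 ≤ m ∧ ParametrizesOrbits (Subgroup.closure (Set.range ρ))
      ((Set.range ρ * (Set.range ρ)⁻¹) ^ m) := by
  have := hX.locallyOfFiniteType
  have := hX.quasiCompact
  have hR : IsIrreducibleConstructible (Set.range ρ * (Set.range ρ)⁻¹) :=
    have h : IsIrreducibleConstructible (Set.range ρ) := ⟨A, hA, ρ, hρ, rfl⟩
    h.mul (h.inv hX)
  have hpow (m : ℕ) (hm : 1 ≤ m) :
      IsIrreducibleConstructible ((Set.range ρ * (Set.range ρ)⁻¹) ^ m) := by
    induction m, hm using Nat.le_induction with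
    | base => rwa [pow_one]
    | succ m _ ih => rw [pow_succ]; exact ih.mul hR
  have hcov := isOrbitCover_range_pow h1
  obtain ⟨_, ⟨m, hm, rfl⟩, h⟩ := hcov.exists_orbit_eq_of_isIrreducibleConstructible (by
    rintro _ ⟨m, hm, rfl⟩
    exact hpow m hm)
  exact ⟨m, hm, hpow m hm, hcov.subset _ ⟨m, hm, rfl⟩, hcov.one_mem _ ⟨m, hm, rfl⟩, h⟩

end Uniformity

section AlgebraicGroups

/-- In a homogeneous Noetherian space every point lies in a single irreducible component, because
some point does. Hence the irreducible components are open. -/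
theorem irreducibleSpace_of_homogeneous {T : Type*} [TopologicalSpace T] [NoetherianSpace T]
    [ConnectedSpace T] (h : ∀ x y : T, ∃ f : T ≃ₜ T, f x = y) : IrreducibleSpace T := by
  obtain ⟨x₀⟩ := ‹ConnectedSpace T›.toNonempty
  let C := irreducibleComponent x₀
  have hC : C ∈ irreducibleComponents T := irreducibleComponent_mem_irreducibleComponents x₀
  have hfin := NoetherianSpace.finite_irreducibleComponents (α := T)
  -- finitely many irreducible components do not cover another one
  obtain ⟨y, hyC, hy⟩ : ∃ y ∈ C, ∀ D ∈ irreducibleComponents T, y ∈ D → D = C := by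
    have : ¬ C ⊆ ⋃₀ (irreducibleComponents T \ {C}) := fun hle ↦
      (mem_of_subset_sUnion_irreducibleComponents C hC _ (hfin.subset Set.sdiff_subset)
        Set.sdiff_subset hle).2 rfl
    obtain ⟨y, hy, hy'⟩ := Set.not_subset.mp this
    refine ⟨y, hy, fun D hD hyD ↦ ?_⟩
    by_contra hne
    exact hy' ⟨D, ⟨hD, hne⟩, hyD⟩
  have huniq {x D D'} (hD : D ∈ irreducibleComponents T) (hD' : D' ∈ irreducibleComponents T)
      (hx : x ∈ D) (hx' : x ∈ D') : D = D' := by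
    obtain ⟨f, rfl⟩ := h x y
    have hirr : IsIrreducible (f ⁻¹' C) := by
      rw [← f.image_symm]
      exact hC.1.image _ f.symm.continuous.continuousOn
    have hsub {E} (hE : E ∈ irreducibleComponents T) (hx : x ∈ E) : E = f ⁻¹' C := by
      refine subset_antisymm ?_ (hE.2 hirr ?_) <;> rw [← Set.image_subset_iff] <;>
      · obtain ⟨E', hE', hle⟩ := exists_mem_irreducibleComponents_subset_of_isIrreducible _
          (hE.1.image f f.continuous.continuousOn)
        rwa [← hy E' hE' (hle ⟨x, hx, rfl⟩)]
    rw [hsub hD hx, hsub hD' hx']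
  have hcompl : Cᶜ = ⋃₀ (irreducibleComponents T \ {C}) := by
    ext x
    constructor
    · intro hx
      refine ⟨_, ⟨irreducibleComponent_mem_irreducibleComponents x, fun he ↦ hx ?_⟩,
        mem_irreducibleComponent⟩
      exact Set.mem_of_mem_of_subset mem_irreducibleComponent (Set.mem_singleton_iff.mp he).subset
    · rintro ⟨D, ⟨hD, hne⟩, hx⟩ hxC
      exact hne (huniq hD hC hx hxC)
  have hclopen : IsClopen C := by
    refine ⟨isClosed_of_mem_irreducibleComponents C hC, ?_⟩
    rw [← isClosed_compl_iff, hcompl]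
    rw [Set.sUnion_eq_biUnion]
    exact (hfin.subset Set.sdiff_subset).isClosed_biUnion
      fun D hD ↦ isClosed_of_mem_irreducibleComponents D hD.1
  have hirr := hC.1
  rw [hclopen.eq_univ ⟨y, hyC⟩] at hirr
  exact (irreducibleSpace_def T).mpr hirr

variable {k : Type u} [Field k] [IsAlgClosed k] {X : Over (Spec (.of k))}

theorem Points.connectedSpace [LocallyOfFiniteType X.hom] [ConnectedSpace X.left] :
    ConnectedSpace (Points X) := by
  obtain ⟨x, -⟩ := exists_toScheme_mem (X := X) (Set.univ_nonempty) isOpen_univ.isLocallyClosed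
  have : PreconnectedSpace (Points X) := by
    rw [preconnectedSpace_iff_clopen]
    intro s hs
    obtain ⟨U, hU, rfl⟩ := isInducing_toScheme.isOpen_iff.mp hs.2
    obtain ⟨V, hV, hUV⟩ := isInducing_toScheme.isClosed_iff.mp hs.1
    have h (W : Set X.left) (hW : IsLocallyClosed W)
        (hemp : toScheme ⁻¹' W = (∅ : Set (Points X))) : W = ∅ := by
      by_contra hne
      obtain ⟨x, hx⟩ := exists_toScheme_mem (Set.nonempty_iff_ne_empty.mpr hne) hW
      exact (hemp.subset hx : x ∈ (∅ : Set (Points X)))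
    have h1 : U ⊆ V := by
      rw [← Set.sdiff_eq_empty]
      refine h _ (hU.isLocallyClosed.inter hV.isOpen_compl.isLocallyClosed) ?_
      rw [Set.preimage_sdiff, hUV, Set.sdiff_self]
    have h2 : V ⊆ U := by
      rw [← Set.sdiff_eq_empty]
      refine h _ (hV.isLocallyClosed.inter hU.isClosed_compl.isLocallyClosed) ?_
      rw [Set.preimage_sdiff, hUV, Set.sdiff_self]
    obtain rfl := h1.antisymm h2
    rcases isClopen_iff.mp ⟨hV, hU⟩ with rfl | rfl
    · exact Or.inl rfl
    · exact Or.inr rfl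
  exact ⟨⟨x⟩⟩

/-- A connected algebraic group is irreducible, since its translations act transitively. -/
theorem Points.irreducibleSpace_of_grpObj (H : Over (Spec (.of k))) [GrpObj H]
    [LocallyOfFiniteType H.hom] [QuasiCompact H.hom] [ConnectedSpace H.left] :
    IrreducibleSpace (Points H) := by
  have := Points.connectedSpace (X := H)
  refine irreducibleSpace_of_homogeneous fun x y ↦ ?_
  let α := (GrpObj.mulRight (A := H) x).symm ≪≫ GrpObj.mulRight (A := H) y
  refine ⟨⟨⟨fun z ↦ z ≫ α.hom, fun z ↦ z ≫ α.inv, fun z ↦ by simp, fun z ↦ by simp⟩,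
    continuous_comp α.hom, continuous_comp α.inv⟩, ?_⟩
  change x ≫ α.hom = y
  dsimp only [Iso.trans_hom, Iso.symm_hom, α]
  rw [← Category.assoc, ← Iso.eq_comp_inv]
  simp [comp_lift_assoc]

theorem IsConnectedAlgebraicSubgroup.isIrreducibleConstructible {G : Subgroup (Aut X)}
    (h : IsConnectedAlgebraicSubgroup G) : IsIrreducibleConstructible (G : Set (Aut X)) := by
  obtain ⟨H, _, ⟨_, _, _, _⟩, _, ρ, hρ, rfl⟩ := h
  have := Points.irreducibleSpace_of_grpObj H
  exact hρ.isIrreducibleConstructible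

theorem exists_orbit_eq_of_directedOn (hX : IsVariety X) {G : Subgroup (Aut X)}
    {S : Set (Subgroup (Aut X))} (hS : ∀ H ∈ S, IsConnectedAlgebraicSubgroup H)
    (hcov : (G : Set (Aut X)) = ⋃ H ∈ S, (H : Set (Aut X))) (hdir : DirectedOn (· ≤ ·) S) :
    ∃ H ∈ S, ∀ x : Points X, MulAction.orbit G x = MulAction.orbit H x := by
  have := hX.locallyOfFiniteType
  have := hX.quasiCompact
  have hle {H} (hH : H ∈ S) : (H : Set (Aut X)) ⊆ G := by
    rw [hcov]
    exact Set.subset_biUnion_of_mem (u := fun H : Subgroup (Aut X) ↦ (H : Set (Aut X))) hH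
  have h : IsOrbitCover G ((fun H : Subgroup (Aut X) ↦ (H : Set (Aut X))) '' S) := by
    refine ⟨?_, ?_, fun g hg ↦ ?_, ?_, ?_⟩
    · rintro _ ⟨H, hH, rfl⟩
      exact hle hH
    · rintro _ ⟨H, hH, rfl⟩
      exact H.one_mem
    · have hg : g ∈ (G : Set (Aut X)) := hg
      rw [hcov] at hg
      obtain ⟨H, hH, hg⟩ := Set.mem_iUnion₂.mp hg
      exact ⟨_, ⟨H, hH, rfl⟩, hg⟩
    · rintro _ ⟨H₁, h₁, rfl⟩ _ ⟨H₂, h₂, rfl⟩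
      obtain ⟨H, hH, hle₁, hle₂⟩ := hdir H₁ h₁ H₂ h₂
      exact ⟨_, ⟨H, hH, rfl⟩, (Set.mul_subset_mul hle₁ hle₂).trans (by simp)⟩
    · rintro _ ⟨H, hH, rfl⟩
      exact ⟨_, ⟨H, hH, rfl⟩, by simp⟩
  obtain ⟨_, ⟨H, hH, rfl⟩, hx⟩ := h.exists_orbit_eq_of_isIrreducibleConstructible (by
    rintro _ ⟨H, hH, rfl⟩
    exact (hS H hH).isIrreducibleConstructible)
  refine ⟨H, hH, fun x ↦ (hx x).trans ?_⟩
  ext y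
  constructor
  · rintro ⟨g, hg, rfl⟩
    exact ⟨⟨g, hg⟩, rfl⟩
  · rintro ⟨g, rfl⟩
    exact ⟨g, g.2, rfl⟩

end AlgebraicGroups

end AutVariety

/-! ### Orbits are locally closed and smooth -/

namespace AutVariety

open TopologicalSpace Topology IsLocalRing Order

section Orbits

/-- The translates of an open subset of the closure contained in the orbit cover the orbit. -/
theorem isLocallyClosed_orbit {M P : Type*} [Group M] [TopologicalSpace P] [MulAction M P]
    [ContinuousConstSMul M P] {G : Subgroup M} {x : P}
    (h : ContainsOpenOfClosure (MulAction.orbit G x)) : IsLocallyClosed (MulAction.orbit G x) := by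
  obtain ⟨U, hU, ⟨y, hy, hyU⟩, hsub⟩ := h
  have hst (g : G) {z : P} (hz : z ∈ closure (MulAction.orbit G x)) :
      g • z ∈ closure (MulAction.orbit G x) := by
    have := image_closure_subset_closure_image (f := fun z : P ↦ g • z)
      (s := MulAction.orbit G x) (continuous_const_smul (g : M))
    refine closure_mono ?_ (this ⟨z, hz, rfl⟩)
    rintro _ ⟨w, hw, rfl⟩
    exact MulAction.mem_orbit_of_mem_orbit g hw
  refine ⟨⋃ g : G, (fun z ↦ g • z) ⁻¹' U, closure (MulAction.orbit G x),
    isOpen_iUnion fun g ↦ hU.preimage (continuous_const_smul (g : M)), isClosed_closure, ?_⟩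
  ext z
  constructor
  · intro hz
    rw [← MulAction.orbit_eq_iff.mpr hz] at hy
    obtain ⟨g, rfl⟩ := hy
    exact ⟨Set.mem_iUnion.mpr ⟨g, hyU⟩, subset_closure hz⟩
  · rintro ⟨hz, hz'⟩
    obtain ⟨g, hg⟩ := Set.mem_iUnion.mp hz
    have := MulAction.mem_orbit_of_mem_orbit g⁻¹ (hsub ⟨hst g hz', hg⟩)
    rwa [inv_smul_smul] at this

/-- A morphism from a reduced scheme factors through a closed subscheme if it does so on points. -/
theorem exists_comp_eq_of_range_subset {Y Z X : Scheme.{u}} (i : Z ⟶ X) [IsClosedImmersion i]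
    (f : Y ⟶ X) [IsReduced Y] (h : Set.range f ⊆ Set.range i) : ∃ l : Y ⟶ Z, l ≫ i = f := by
  have : Surjective (Limits.pullback.fst f i) := by
    rw [surjective_iff, ← Set.range_eq_univ, Scheme.Pullback.range_fst, Set.eq_univ_iff_forall]
    exact fun y ↦ h ⟨y, rfl⟩
  have := isIso_of_isClosedImmersion_of_surjective (Limits.pullback.fst f i)
  exact ⟨CategoryTheory.inv (Limits.pullback.fst f i) ≫ Limits.pullback.snd f i, by
    rw [Category.assoc, ← Limits.pullback.condition, IsIso.inv_hom_id_assoc]⟩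

variable {k : Type u} [Field k] {X : Over (Spec (.of k))}

theorem exists_hom_reducedClosed (g : X ⟶ X) {Z : Closeds X.left}
    (h : Set.MapsTo g.left Z Z) :
    ∃ l : reducedClosed Z ⟶ reducedClosed Z, l ≫ reducedClosedHom Z = reducedClosedHom Z ≫ g := by
  obtain ⟨l, hl⟩ := exists_comp_eq_of_range_subset (reducedClosedHom Z).left
    (reducedClosedHom Z ≫ g).left (by
      rintro _ ⟨z, rfl⟩
      rw [range_reducedClosedHom]
      exact h ((range_reducedClosedHom Z).le ⟨z, rfl⟩))
  refine ⟨Over.homMk l ?_, Over.OverMorphism.ext hl⟩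
  rw [← Over.w (reducedClosedHom Z), ← Category.assoc, hl, Over.w, Over.w]

theorem exists_iso_reducedClosed (g : X ≅ X) {Z : Closeds X.left}
    (h : Set.MapsTo g.hom.left Z Z) (h' : Set.MapsTo g.inv.left Z Z) :
    ∃ l : reducedClosed Z ≅ reducedClosed Z,
      l.hom ≫ reducedClosedHom Z = reducedClosedHom Z ≫ g.hom := by
  obtain ⟨l, hl⟩ := exists_hom_reducedClosed g.hom h
  obtain ⟨l', hl'⟩ := exists_hom_reducedClosed g.inv h'
  have : Mono (reducedClosedHom Z) := (Over.forget _).mono_of_mono_map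
    (inferInstanceAs (Mono (reducedClosedHom Z).left))
  refine ⟨⟨l, l', ?_, ?_⟩, hl⟩ <;> rw [← cancel_mono (reducedClosedHom Z)]
  · rw [Category.assoc, hl', ← Category.assoc, hl, Category.assoc, Iso.hom_inv_id,
      Category.comp_id, Category.id_comp]
  · rw [Category.assoc, hl, ← Category.assoc, hl', Category.assoc, Iso.inv_hom_id,
      Category.comp_id, Category.id_comp]

theorem mem_smoothLocus_iff {Y : Over (Spec (.of k))} [LocallyOfFinitePresentation X.hom]
    [LocallyOfFinitePresentation Y.hom] (f : X ⟶ Y) [IsOpenImmersion f.left] (p : X.left) :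
    f.left p ∈ Y.hom.smoothLocus ↔ p ∈ X.hom.smoothLocus := by
  have h : f.left ⁻¹ᵁ Y.hom.smoothLocus = X.hom.smoothLocus := by
    rw [Scheme.Hom.preimage_smoothLocus_eq]
    congr 1
    exact Over.w f
  rw [← h]
  rfl

variable [IsAlgClosed k]

/-- A reduced scheme over a perfect field is smooth on a dense open subset. The smooth locus of the
closure of an orbit thus meets the orbit, and it is stable under `G`. -/
theorem isSmoothSubvariety_orbit (hX : IsVariety X) {G : Subgroup (Aut X)} {x : Points X}
    (hO : IsLocallyClosed (MulAction.orbit G x)) :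
    IsSmoothSubvariety (MulAction.orbit G x) := by
  obtain ⟨_, _, _, _⟩ := hX
  let S : Set X.left := Points.toScheme '' MulAction.orbit G x
  let Z : Closeds X.left := ⟨closure S, isClosed_closure⟩
  have hZ : (Z : Set X.left) = closure S := rfl
  obtain ⟨W, hW, hWO⟩ : ∃ W, IsOpen W ∧ Points.toScheme ⁻¹' (W ∩ Z) = MulAction.orbit G x := by
    obtain ⟨U, C, hU, hC, h⟩ := hO
    obtain ⟨W, hW, rfl⟩ := Points.isInducing_toScheme.isOpen_iff.mp hU
    refine ⟨W, hW, ?_⟩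
    rw [Set.preimage_inter, hZ, ← Points.isInducing_toScheme.closure_eq_preimage_closure_image]
    refine subset_antisymm (fun y hy ↦ ?_) fun y hy ↦ ⟨(h.le hy).1, subset_closure hy⟩
    rw [h]
    exact ⟨hy.1, closure_minimal (h.le.trans Set.inter_subset_right) hC hy.2⟩
  have hstab (g : G) : Set.MapsTo (g : Aut X).hom.left Z Z := by
    rw [hZ]
    refine Set.MapsTo.closure ?_ (g : Aut X).hom.left.continuous
    rintro _ ⟨y, hy, rfl⟩
    exact ⟨g • y, MulAction.mem_orbit_of_mem_orbit g hy, rfl⟩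
  let C := reducedClosed Z
  let i : C ⟶ X := reducedClosedHom Z
  have := isLocallyNoetherian_left (X := C)
  have : LocallyOfFinitePresentation C.hom :=
    LocallyOfFinitePresentation.iff_locallyOfFiniteType.mpr inferInstance
  let V : C.left.Opens := ⟨i.left ⁻¹' W, hW.preimage i.left.continuous⟩
  have hrange : i.left '' V = W ∩ Z := by
    refine (Set.image_preimage_eq_inter_range).trans ?_
    rw [range_reducedClosedHom]
  have hsmooth : V ≤ C.hom.smoothLocus := by
    have hxV : x.toScheme ∈ i.left '' V := by
      rw [hrange]
      exact hWO.ge (MulAction.mem_orbit_self x)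
    obtain ⟨c, hc, -⟩ := hxV
    obtain ⟨c₀, hc₀, hc₀'⟩ := C.hom.dense_smoothLocus_of_perfectField.inter_open_nonempty V V.2
      ⟨c, hc⟩
    obtain ⟨c₀, hc₀⟩ := Points.exists_toScheme_mem (X := C)
      (Z := V ∩ (C.hom.smoothLocus : Set C.left)) ⟨c₀, hc₀, hc₀'⟩
      (V.2.inter C.hom.smoothLocus.2).isLocallyClosed
    have hmem (c : Points C) (hc : c.toScheme ∈ V) : c ≫ i ∈ MulAction.orbit G x :=
      hWO.le (hrange.le ⟨c.toScheme, hc, rfl⟩)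
    by_contra hne
    obtain ⟨d, hd, hd'⟩ := Set.not_subset.mp hne
    obtain ⟨d, hd, hd'⟩ := Points.exists_toScheme_mem (X := C)
      (Z := V ∩ (C.hom.smoothLocus : Set C.left)ᶜ) ⟨d, hd, hd'⟩
      (V.2.isLocallyClosed.inter C.hom.smoothLocus.2.isClosed_compl.isLocallyClosed)
    obtain ⟨g, hg⟩ : ∃ g : G, g • (d ≫ i) = c₀ ≫ i := by
      have := hmem c₀ hc₀.1
      rwa [← MulAction.orbit_eq_iff.mpr (hmem d hd)] at this
    obtain ⟨l, hl⟩ := exists_iso_reducedClosed (g : Aut X) (hstab g) (hstab g⁻¹)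
    have hdl : d ≫ l.hom = c₀ := by
      have : Mono i := (Over.forget _).mono_of_mono_map (inferInstanceAs (Mono i.left))
      rw [← cancel_mono i, ← hg, Category.assoc, hl, ← Category.assoc]
      rfl
    have h1 : l.hom.left d.toScheme = c₀.toScheme := by rw [← Points.toScheme_comp, hdl]
    have h2 : l.hom.left d.toScheme ∈ C.hom.smoothLocus := h1 ▸ hc₀.2
    have : IsIso l.hom.left := inferInstanceAs (IsIso ((Over.forget _).map l.hom))
    exact hd' ((mem_smoothLocus_iff l.hom _).mp h2)
  let Y : Over (Spec (.of k)) := Over.mk (V.ι ≫ C.hom)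
  let j : Y ⟶ C := Over.homMk V.ι
  have : IsOpenImmersion j.left := inferInstanceAs (IsOpenImmersion V.ι)
  have : LocallyOfFinitePresentation Y.hom :=
    inferInstanceAs (LocallyOfFinitePresentation (V.ι ≫ C.hom))
  have hYs : AlgebraicGeometry.Smooth Y.hom := by
    apply Scheme.Hom.smoothLocus_eq_top_iff.mp
    exact top_le_iff.mp fun y _ ↦ (mem_smoothLocus_iff j y).mp (hsmooth y.2)
  have : LocallyOfFiniteType Y.hom := inferInstanceAs (LocallyOfFiniteType (V.ι ≫ C.hom))
  refine ⟨Y, ⟨inferInstanceAs (IsReduced V), inferInstanceAs (IsSeparated (V.ι ≫ C.hom)), ?_,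
    inferInstanceAs (QuasiCompact (V.ι ≫ C.hom))⟩, hYs, j ≫ i,
    inferInstanceAs (IsImmersion (V.ι ≫ i.left)), ?_⟩
  · infer_instance
  rw [← hWO, ← hrange]
  have hj : i.left '' V = Set.range (j ≫ i).left := by
    refine Eq.trans ?_ (Set.range_comp i.left V.ι).symm
    rw [Scheme.Opens.range_ι]
  ext y
  constructor
  · rintro ⟨z, rfl⟩
    exact hj.ge ⟨z.toScheme, rfl⟩
  · intro hy
    obtain ⟨z, -, hz⟩ := Points.exists_comp_eq (f := j ≫ i) (Z := Set.univ)
      isOpen_univ.isLocallyClosed y (by rw [Set.image_univ]; exact hj.le hy)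
    exact ⟨z, hz⟩

theorem ParametrizesOrbits.isLocallyClosed_orbit [LocallyOfFiniteType X.hom] [QuasiCompact X.hom]
    {G : Subgroup (Aut X)} {V : Set (Aut X)}
    (h : ParametrizesOrbits G V) (x : Points X) : IsLocallyClosed (MulAction.orbit G x) := by
  apply AutVariety.isLocallyClosed_orbit
  rw [h.orbit_eq]
  obtain ⟨A, ⟨⟨_, _, _, _⟩, hA⟩, ρ, ⟨φ, hφ⟩, rfl⟩ := h.isIrreducibleConstructible
  rw [← Points.irreducibleSpace_iff] at hA
  have heq : (fun g : Aut X ↦ g • x) '' Set.range ρ =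
      (fun a : Points A ↦ a ≫ lift (𝟙 A) (toUnit A ≫ x) ≫ φ) '' Set.univ := by
    rw [← Set.range_comp, Set.image_univ]
    congr 1
    ext a
    rw [← Category.assoc, ← lift_eq_comp_left, hφ]
    rfl
  rw [heq]
  exact Points.containsOpenOfClosure_image _ isClosed_univ (IrreducibleSpace.isIrreducible_univ _)

end Orbits

end AutVariety

/-! ### Semicontinuity of the orbit dimension -/

namespace AutVariety

open TopologicalSpace Topology IsLocalRing Order

section Semicontinuity

theorem quasiFiniteAt_iff_exists_isOpen {Y Z : Scheme.{u}} {f : Y ⟶ Z} [LocallyOfFiniteType f]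
    {y : Y} : f.QuasiFiniteAt y ↔ ∃ U : Set Y, IsOpen U ∧ U ∩ f ⁻¹' {f y} = {y} := by
  rw [Scheme.Hom.quasiFiniteAt_iff_isOpen_singleton_asFiber, Scheme.Hom.asFiber,
    ← (f.fiberHomeo (f y)).isOpen_image, Set.image_singleton, Homeomorph.apply_symm_apply,
    isOpen_induced_iff]
  refine exists_congr fun U ↦ and_congr_right fun _ ↦ ?_
  rw [← Set.image_eq_image Subtype.val_injective, Subtype.image_preimage_coe, Set.image_singleton,
    Set.inter_comm]

variable {k : Type u} [Field k] {X Y Z A : Over (Spec (.of k))}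

/-- The map `a ↦ φ(a, x)`, which is the orbit map of `x` if `φ` is a family of automorphisms. -/
noncomputable abbrev orbitMap (φ : A ⊗ X ⟶ X) (x : Points X) : A ⟶ X :=
  lift (𝟙 A) (toUnit A ≫ x) ≫ φ

theorem comp_orbitMap (φ : A ⊗ X ⟶ X) (x : Points X) (a : Points A) :
    a ≫ orbitMap φ x = lift a x ≫ φ := by
  rw [← Category.assoc, ← lift_eq_comp_left]

/-- For a morphism `f`, there is a closed subvariety `closure {b}` of the source on which `f` is
quasi-finite at the generic point `b'`, and such that `f b' = f a`. One takes for `b` a closed point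
of the fibre of `f` over `f a`. -/
theorem exists_quasiFiniteAt_reducedClosed [LocallyOfFiniteType A.hom] [QuasiCompact A.hom]
    [LocallyOfFiniteType X.hom] [IsSeparated X.hom] (f : A ⟶ X) (a : A.left) :
    ∃ b : A.left, f.left b = f.left a ∧
      ∃ b' : (reducedClosed (X := A) ⟨closure {b}, isClosed_closure⟩).left,
      (reducedClosedHom _).left b' = b ∧ closure {b'} = Set.univ ∧
      (reducedClosedHom _ ≫ f).left.QuasiFiniteAt b' := by
  have := locallyOfFiniteType_left f
  have : QuasiCompact f.left := by
    have : QuasiCompact (f.left ≫ X.hom) := by rw [Over.w f]; infer_instance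
    exact QuasiCompact.of_comp f.left X.hom
  obtain ⟨c, -, hc⟩ := IsClosed.exists_closed_singleton (X := f.left.fiber (f.left a))
    isClosed_univ ⟨f.left.asFiber a, trivial⟩
  let b := f.left.fiberι (f.left a) c
  have hmem (q : A.left) : q ∈ Set.range (f.left.fiberι (f.left a)) ↔ f.left q = f.left a := by
    rw [Scheme.Hom.range_fiberι]
    rfl
  have hb : f.left b = f.left a := (hmem b).mp ⟨c, rfl⟩
  have hbq (q : A.left) (h : b ⤳ q) (hq : f.left q = f.left a) : q = b := by
    obtain ⟨c', rfl⟩ := (hmem q).mpr hq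
    have : c ⤳ c' := (f.left.fiberι (f.left a)).isEmbedding.isInducing.specializes_iff.mp h
    have hc' : c' = c := this.mem_closed hc rfl
    rw [hc']
  let i := reducedClosedHom (X := A) ⟨closure {b}, isClosed_closure⟩
  have hi : Set.range i.left = closure {b} := range_reducedClosedHom _
  obtain ⟨b', hb'⟩ : b ∈ Set.range i.left := hi.ge (subset_closure rfl)
  have hind : IsEmbedding i.left := i.left.isEmbedding
  refine ⟨b, hb, b', hb', ?_, ?_⟩
  · refine Set.eq_univ_of_forall fun d ↦ (hind.isInducing.specializes_iff.mp ?_).mem_closure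
    refine specializes_iff_mem_closure.mpr (hi.le.trans ?_ ⟨d, rfl⟩)
    exact (congrArg (fun x ↦ closure {x}) hb').ge
  · have := locallyOfFiniteType_left (i ≫ f)
    rw [quasiFiniteAt_iff_exists_isOpen]
    refine ⟨Set.univ, isOpen_univ, ?_⟩
    rw [Set.univ_inter]
    refine subset_antisymm (fun d hd ↦ hind.injective ?_) (Set.singleton_subset_iff.mpr rfl)
    refine (hbq (i.left d) ?_ ?_).trans hb'.symm
    · exact specializes_iff_mem_closure.mpr (hi.le ⟨d, rfl⟩)
    · exact (show f.left (i.left d) = f.left (i.left b') from hd).trans (by rw [hb', hb])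

variable [IsAlgClosed k]

/-- A morphism is quasi-finite at a rational point if and only if this point is isolated among the
rational points of its fibre. -/
theorem Points.quasiFiniteAt_iff [LocallyOfFiniteType Y.hom] [LocallyOfFiniteType Z.hom]
    (f : Y ⟶ Z) (y : Points Y) : f.left.QuasiFiniteAt y.toScheme ↔
      ∃ U : Set (Points Y), IsOpen U ∧ y ∈ U ∧ ∀ y' ∈ U, y' ≫ f = y ≫ f → y' = y := by
  have := locallyOfFiniteType_left f
  rw [quasiFiniteAt_iff_exists_isOpen]
  constructor
  · rintro ⟨U, hU, h⟩
    refine ⟨toScheme ⁻¹' U, hU.preimage isInducing_toScheme.continuous, (h.ge rfl).1,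
      fun y' hy' he ↦ toScheme_injective ?_⟩
    exact h.le ⟨hy', congrArg toScheme he⟩
  · rintro ⟨_, hU', hy, h⟩
    obtain ⟨U, hU, rfl⟩ := isInducing_toScheme.isOpen_iff.mp hU'
    refine ⟨U, hU, subset_antisymm ?_ (Set.singleton_subset_iff.mpr ⟨hy, rfl⟩)⟩
    have hlc : IsLocallyClosed (U ∩ f.left ⁻¹' {f.left y.toScheme}) := by
      refine hU.isLocallyClosed.inter (IsClosed.isLocallyClosed ?_)
      exact (isClosed_singleton_toScheme (y ≫ f)).preimage f.left.continuous
    refine subset_closure.trans ?_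
    rw [← closure_toScheme_image_preimage hlc]
    refine closure_minimal ?_ (isClosed_singleton_toScheme y)
    rintro _ ⟨y', ⟨hy', he⟩, rfl⟩
    exact congrArg toScheme (h y' hy' (toScheme_injective he))

variable (φ : A ⊗ X ⟶ X)

theorem closure_orbitMap_genericPoint [LocallyOfFiniteType A.hom]
    [IrreducibleSpace A.left] (x : Points X) {O : Set (Points X)}
    (hO : O = Set.range fun a : Points A ↦ lift a x ≫ φ) :
    closure {(orbitMap φ x).left (genericPoint A.left)} = closure (Points.toScheme '' O) := by
  have h1 : Points.toScheme '' O = (orbitMap φ x).left ''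
      (Points.toScheme '' (Points.toScheme ⁻¹' Set.univ : Set (Points A))) := by
    rw [hO, ← Set.range_comp, Set.preimage_univ, Set.image_univ, ← Set.range_comp]
    congr 1
    ext a
    simp only [Function.comp_apply, ← comp_orbitMap, Points.toScheme_comp]
  rw [h1, ← Set.image_singleton, ← closure_image_closure (orbitMap φ x).left.continuous,
    ← closure_image_closure (s := Points.toScheme '' _) (orbitMap φ x).left.continuous,
    genericPoint_closure, Points.closure_toScheme_image_preimage isOpen_univ.isLocallyClosed,
    closure_univ]

/-- Lower semicontinuity of the dimension of the image of an orbit map. There is a closed subvariety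
`B` of `A` on which the orbit map of `x₀` is generically quasi-finite and has an image of the same
dimension. The morphism `(b, x) ↦ (φ(b, x), x)` on `B × X` is quasi-finite at the points `(b, x)`
such that the orbit map of `x` is quasi-finite at `b`, and its quasi-finite locus is open by
Zariski's main theorem. Thus the orbit maps of all `x` near `x₀` are generically quasi-finite on `B`. -/
theorem eventually_residueTrdeg_le [LocallyOfFiniteType A.hom] [QuasiCompact A.hom]
    [LocallyOfFiniteType X.hom] [IsSeparated X.hom] [IrreducibleSpace A.left] (x₀ : Points X) :
    ∀ᶠ x in 𝓝 x₀, residueTrdeg X ((orbitMap φ x₀).left (genericPoint A.left)) ≤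
      residueTrdeg X ((orbitMap φ x).left (genericPoint A.left)) := by
  obtain ⟨b, hb, b', hb', hgen, hqf⟩ :=
    exists_quasiFiniteAt_reducedClosed (orbitMap φ x₀) (genericPoint A.left)
  let B : Over (Spec (.of k)) := reducedClosed (X := A) ⟨closure {b}, isClosed_closure⟩
  let i : B ⟶ A := reducedClosedHom _
  have hlft (x : Points X) := locallyOfFiniteType_left (i ≫ orbitMap φ x)
  -- a rational point of `B` at which the orbit map of `x₀` is quasi-finite
  obtain ⟨b₀, hb₀⟩ := Points.exists_toScheme_mem (X := B) ⟨b', hqf⟩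
    (i ≫ orbitMap φ x₀).left.isOpen_quasiFiniteAt.isLocallyClosed
  let Ψ : B ⊗ X ⟶ X ⊗ X := lift (i ▷ X ≫ φ) (snd B X)
  have hΨ (b : Points B) (x : Points X) : lift b x ≫ Ψ = lift (b ≫ i ≫ orbitMap φ x) x := by
    rw [comp_lift, lift_snd, ← Category.assoc, comp_whiskerRight_lift, ← Category.assoc b i,
      comp_orbitMap]
  have := locallyOfFiniteType_left Ψ
  have hΨqf (x : Points X) :
      Ψ.left.QuasiFiniteAt (Points.toScheme (lift b₀ x)) ↔
        (i ≫ orbitMap φ x).left.QuasiFiniteAt b₀.toScheme := by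
    rw [Points.quasiFiniteAt_iff, Points.quasiFiniteAt_iff]
    constructor
    · rintro ⟨U, hU, hmem, h⟩
      refine ⟨(fun b ↦ lift b x) ⁻¹' U, hU.preimage ?_, hmem, fun b hb he ↦ ?_⟩
      · simp only [lift_eq_comp_left]
        exact Points.continuous_comp _
      · have := h _ hb (by rw [hΨ, hΨ, he])
        simpa using congr($this ≫ fst B X)
    · rintro ⟨U, hU, hmem, h⟩
      refine ⟨(fun p ↦ p ≫ fst B X) ⁻¹' U, hU.preimage (Points.continuous_comp _), by simpa,
        fun p hp he ↦ ?_⟩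
      rw [← lift_comp_fst_snd p] at he ⊢
      rw [hΨ, hΨ] at he
      have hx : p ≫ snd B X = x := by simpa using congr($he ≫ snd X X)
      rw [hx] at he ⊢
      exact congr(lift $(h _ hp (by simpa using congr($he ≫ fst X X))) x)
  have hopen : IsOpen {x : Points X | (i ≫ orbitMap φ x).left.QuasiFiniteAt b₀.toScheme} := by
    simp only [← hΨqf, lift_eq_comp_right]
    exact (Ψ.left.isOpen_quasiFiniteAt.preimage Points.isInducing_toScheme.continuous).preimage
      (Points.continuous_comp _)
  filter_upwards [hopen.mem_nhds hb₀] with x hx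
  have hqf' : (i ≫ orbitMap φ x).left.QuasiFiniteAt b' := by
    have h : b' ⤳ b₀.toScheme := by
      rw [specializes_iff_mem_closure, hgen]
      trivial
    exact h.mem_open (i ≫ orbitMap φ x).left.isOpen_quasiFiniteAt hx
  have h0 : (i ≫ orbitMap φ x₀).left b' = (orbitMap φ x₀).left (genericPoint A.left) := by
    rw [← hb, ← hb']
    rfl
  rw [← h0, residueTrdeg_eq_of_quasiFiniteAt _ hqf, ← residueTrdeg_eq_of_quasiFiniteAt _ hqf']
  apply residueTrdeg_le
  exact (genericPoint_specializes (i.left b')).map (orbitMap φ x).left.continuous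

end Semicontinuity

section MaxLocus

variable {k : Type u} [Field k] [IsAlgClosed k] {X : Over (Spec (.of k))}

/-- The dimension of orbits is a bounded, lower semicontinuous function with natural values. -/
theorem exists_orbitDim_eq (hX : IsVariety X) {G : Subgroup (Aut X)}
    (hG : IsConnectedSubgroup G) :
    ∃ d : Points X → ℕ, (∀ x, orbitDim G x = d x) ∧ (∀ x₀, ∀ᶠ x in 𝓝 x₀, d x₀ ≤ d x) ∧
      ∃ n, ∀ x, d x ≤ n := by
  obtain ⟨V, hV⟩ := exists_parametrizesOrbits hX hG
  obtain ⟨_, _, _, _⟩ := hX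
  have hlc := hV.isLocallyClosed_orbit
  obtain ⟨A, ⟨⟨_, _, _, _⟩, hA⟩, ρ, ⟨φ, hφ⟩, rfl⟩ := hV.isIrreducibleConstructible
  obtain ⟨n, hn⟩ := exists_residueTrdeg_le X
  refine ⟨fun x ↦ residueTrdeg X ((orbitMap φ x).left (genericPoint A.left)), fun x ↦ ?_,
    fun x₀ ↦ eventually_residueTrdeg_le φ x₀, n, fun x ↦ hn _⟩
  refine Points.topologicalKrullDim_eq_residueTrdeg (hlc x) (closure_orbitMap_genericPoint φ x ?_)
  rw [hV.orbit_eq, ← Set.range_comp]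
  simp only [hφ]
  rfl

theorem isOpen_maxLocus (hX : IsVariety X) {G : Subgroup (Aut X)} (hG : IsConnectedSubgroup G) :
    IsOpen (maxLocus G) ∧ (Nonempty (Points X) → (maxLocus G).Nonempty) := by
  obtain ⟨d, hd, hsc, n, hn⟩ := exists_orbitDim_eq hX hG
  have hmem (x : Points X) (hx : orbitDim G x = maxOrbitDim G) : x ∈ maxLocus G :=
    Set.mem_iUnion₂.mpr ⟨x, hx, MulAction.mem_orbit_self x⟩
  have hle (x : Points X) : orbitDim G x ≤ maxOrbitDim G := le_iSup (orbitDim G) x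
  constructor
  · rw [isOpen_iff_mem_nhds]
    intro x hx
    obtain ⟨y, hy, hxy⟩ := Set.mem_iUnion₂.mp hx
    have hx : orbitDim G x = maxOrbitDim G := by
      rw [← hy, orbitDim, orbitDim, MulAction.orbit_eq_iff.mpr hxy]
    filter_upwards [hsc x] with z hz
    refine hmem z ((hle z).antisymm ?_)
    rw [← hx, hd, hd]
    exact_mod_cast hz
  · intro ⟨x⟩
    have hfin : (Set.range d).Finite := (Set.finite_Iic n).subset (Set.range_subset_iff.mpr hn)
    obtain ⟨_, ⟨x₀, rfl⟩, hx₀⟩ := Set.exists_max_image (Set.range d) id hfin ⟨d x, x, rfl⟩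
    refine ⟨x₀, hmem x₀ ((hle x₀).antisymm (iSup_le fun y ↦ ?_))⟩
    rw [hd, hd]
    exact_mod_cast hx₀ (d y) ⟨y, rfl⟩

end MaxLocus

end AutVariety

/-! ### Orbits of connected groups of automorphisms -/

open AutVariety in
theorem mainTheorem3 {k : Type u} [Field k] [IsAlgClosed k] (X : Over (Spec (.of k)))
    (hX : IsVariety X) (G : Subgroup (Aut X)) (hG : IsConnectedSubgroup G) :
    -- (1)
    (∀ x : Points X,
      IsOpen ((↑) ⁻¹' MulAction.orbit G x : Set (closure (MulAction.orbit G x))) ∧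
      IsLocallyClosed (MulAction.orbit G x) ∧
      IsSmoothSubvariety (MulAction.orbit G x)) ∧
    -- (2)
    ((∃ V : Set (Aut X), ParametrizesOrbits G V) ∧
      (∀ (A : Over (Spec (.of k))) (ρ : Points A → Aut X), IsIrreducibleVariety A →
        IsMorphism ρ → 1 ∈ Set.range ρ → Subgroup.closure (Set.range ρ) = G →
        ∃ m : ℕ, 1 ≤ m ∧ ParametrizesOrbits G ((Set.range ρ * (Set.range ρ)⁻¹) ^ m))) ∧
    -- (3)
    (IsOpen (maxLocus G) ∧ (Nonempty (Points X) → (maxLocus G).Nonempty)) ∧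
    -- (4)
    (∀ S : Set (Subgroup (Aut X)), (∀ H ∈ S, IsConnectedAlgebraicSubgroup H) →
      (G : Set (Aut X)) = ⋃ H ∈ S, (H : Set (Aut X)) → DirectedOn (· ≤ ·) S →
      ∃ H ∈ S, ∀ x : Points X, MulAction.orbit G x = MulAction.orbit H x) := by
  refine ⟨fun x ↦ ?_, ⟨exists_parametrizesOrbits hX hG, fun A ρ hA hρ h1 hgen ↦ ?_⟩,
    isOpen_maxLocus hX hG, fun S hS hcov hdir ↦ exists_orbit_eq_of_directedOn hX hS hcov hdir⟩
  · obtain ⟨V, hV⟩ := exists_parametrizesOrbits hX hG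
    have := hX.locallyOfFiniteType
    have := hX.quasiCompact
    have hO := hV.isLocallyClosed_orbit x
    exact ⟨hO.isOpen_preimage_val_closure, hO, isSmoothSubvariety_orbit hX hO⟩
  · subst hgen
    exact exists_parametrizesOrbits_pow hX hA hρ h1
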